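/- Let $n\ge 1$, $\gamma\in[1,2)$, and let $u_0\in H^1(\mathbb{R}^n)\cap L^\gamma(\mathbb{R}^n)$ with $u_0\ge 0$ a.e. in $\mathbb{R}^n$. Write $Q=\mathbb{R}^n\times(0,\infty)$ and $Q_r^+=B_r\times(0,r^2)$, where $B_r\subset\mathbb{R}^n$ is the open ball of radius $r$ centred at the origin. Let $$\mathcal U=\bigcap_{r>0}H^1(Q_r^+),\qquad \mathcal U_0=\{u\in\mathcal U:\ u|_{t=0}=u_0 \text{ in the sense of traces}\},$$ and for $\varepsilon\in(0,1)$ and $w\in\mathcal U$ let $$\mathcal J_\varepsilon(w)=\int_0^\infty e^{-t}\left(\int_{\mathbb{R}^n}\left(|\partial_t w|^2+\varepsilon|\nabla w|^2\right)dx+2\varepsilon\int_{\mathbb{R}^n}w_+^\gamma\,dx\right)dt\ \in[0,+\infty],$$ where $\nabla$ is the gradient in $x$, derivatives are weak derivatives, and $w_+=\max\{w,0\}$. Then there is a constant $C>0$, depending only on $n$, $\gamma$ and $u_0$, such that for every $\varepsilon\in(0,1)$ the functional $\mathcal J_\varepsilon$ has a unique minimizer $v_\varepsilon$ in $\mathcal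 U_0$ (unique up to equality a.e. in $Q$), this minimizer satisfies $v_\varepsilon\ge 0$ a.e. in $Q$, and $$\mathcal J_\varepsilon(v_\varepsilon)\le C\varepsilon.$$ -/

import Mathlib

open MeasureTheory Set
open scoped ContDiff ENNReal

namespace ParabolicMin

section Sobolev

variable {V : Type*} [NormedAddCommGroup V] [NormedSpace ℝ V] [MeasureSpace V]

/-- `φ ∈ C_c^∞(Ω)`. -/
structure IsTestFunction (Ω : Set V) (φ : V → ℝ) : Prop where
  smooth : ContDiff ℝ ∞ φ
  compact : HasCompactSupport φ
  support_subset : tsupport φ ⊆ Ω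

/-- `g ∈ L¹_loc(Ω)` is the weak derivative of `u ∈ L¹_loc(Ω)` in the direction `e`,
on the open set `Ω`. -/
structure HasWeakDeriv (Ω : Set V) (u : V → ℝ) (e : V) (g : V → ℝ) : Prop where
  locallyIntegrableOn : LocallyIntegrableOn u Ω volume
  locallyIntegrableOn_deriv : LocallyIntegrableOn g Ω volume
  integral_eq : ∀ φ : V → ℝ, IsTestFunction Ω φ →
    ∫ z in Ω, u z * fderiv ℝ φ z e = - ∫ z in Ω, g z * φ z

open Classical in
/-- The weak derivative of `u` in the direction `e` on `Ω` (determined up to a null set of `Ω`);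
it is `0` if `u` has no weak derivative in the direction `e`. -/
noncomputable def weakDeriv (Ω : Set V) (u : V → ℝ) (e : V) : V → ℝ :=
  if h : ∃ g, HasWeakDeriv Ω u e g then h.choose else 0

/-- `u ∈ H¹(Ω)`: `u ∈ L²(Ω)`, and all its first order weak derivatives exist and are in
`L²(Ω)`. -/
structure MemH1 (Ω : Set V) (u : V → ℝ) : Prop where
  memLp : MemLp u 2 (volume.restrict Ω)
  exists_weakDeriv : ∀ e : V, ∃ g, MemLp g 2 (volume.restrict Ω) ∧ HasWeakDeriv Ω u e g

end Sobolev

/-- Space-time `ℝⁿ × ℝ`, with points `(x, t)`. -/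
abbrev SpaceTime (n : ℕ) : Type := EuclideanSpace ℝ (Fin n) × ℝ

/-- `Q = ℝⁿ × (0, ∞)`. -/
def Q (n : ℕ) : Set (SpaceTime n) := univ ×ˢ Ioi 0

/-- `Q_r^+ = B_r × (0, r²)`. -/
def Qplus (n : ℕ) (r : ℝ) : Set (SpaceTime n) := Metric.ball 0 r ×ˢ Ioo 0 (r ^ 2)

/-- The time direction. -/
def dirT (n : ℕ) : SpaceTime n := (0, 1)

/-- The `i`-th space direction. -/
noncomputable def dirX {n : ℕ} (i : Fin n) : SpaceTime n := (EuclideanSpace.single i 1, 0)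

/-- The weak time derivative of `w` on `Q`. -/
noncomputable def weakDt {n : ℕ} (w : SpaceTime n → ℝ) : SpaceTime n → ℝ :=
  weakDeriv (Q n) w (dirT n)

/-- The squared length `|∇w|²` of the weak spatial gradient of `w` on `Q`. -/
noncomputable def weakGradSq {n : ℕ} (w : SpaceTime n → ℝ) (z : SpaceTime n) : ℝ :=
  ∑ i : Fin n, (weakDeriv (Q n) w (dirX i) z) ^ 2

/-- `𝒰 = ⋂_{r > 0} H¹(Q_r^+)`. -/
def U (n : ℕ) : Set (SpaceTime n → ℝ) := {u | ∀ r : ℝ, 0 < r → MemH1 (Qplus n r) u}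

/-- `u|_{t = 0} = u₀` in the sense of traces, for `u ∈ 𝒰` and `u₀ ∈ L¹_loc(ℝⁿ)`: the trace is
the locally integrable function on the boundary `t = 0` for which Green's formula holds with
every smooth compactly supported `φ` on `ℝⁿ × ℝ` (`φ` need not vanish on `t = 0`). -/
def HasInitialTrace {n : ℕ} (u : SpaceTime n → ℝ) (u₀ : EuclideanSpace ℝ (Fin n) → ℝ) : Prop :=
  ∀ φ : SpaceTime n → ℝ, ContDiff ℝ ∞ φ → HasCompactSupport φ →
    ∫ z in Q n, (u z * fderiv ℝ φ z (dirT n) + weakDt u z * φ z) = - ∫ x, u₀ x * φ (x, 0)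

/-- `𝒰₀ = {u ∈ 𝒰 : u|_{t = 0} = u₀}`. -/
def U0 {n : ℕ} (u₀ : EuclideanSpace ℝ (Fin n) → ℝ) : Set (SpaceTime n → ℝ) :=
  {u | u ∈ U n ∧ HasInitialTrace u u₀}

/-- The rescaled functional
`J_ε(w) = ∫₀^∞ e^{-t} (∫ (|∂ₜw|² + ε |∇w|²) dx + 2 ε ∫ (w₊)^γ dx) dt`, valued in `[0, ∞]`. -/
noncomputable def J {n : ℕ} (γ ε : ℝ) (w : SpaceTime n → ℝ) : ℝ≥0∞ :=
  ∫⁻ t in Ioi (0 : ℝ), ENNReal.ofReal (Real.exp (-t)) *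
    ((∫⁻ x : EuclideanSpace ℝ (Fin n),
        ENNReal.ofReal ((weakDt w (x, t)) ^ 2 + ε * weakGradSq w (x, t)))
      + ENNReal.ofReal (2 * ε) *
        ∫⁻ x : EuclideanSpace ℝ (Fin n), ENNReal.ofReal ((max (w (x, t)) 0) ^ γ))

/-- `v` is a minimizer of `J_ε` in `𝒰₀`. -/
def IsMinimizer {n : ℕ} (γ ε : ℝ) (u₀ : EuclideanSpace ℝ (Fin n) → ℝ)
    (v : SpaceTime n → ℝ) : Prop :=
  v ∈ U0 u₀ ∧ ∀ w ∈ U0 u₀, J γ ε v ≤ J γ ε w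

end ParabolicMin

set_option linter.unusedSectionVars false

namespace ParabolicMin

/-! ### Calculus of weak derivatives -/

section WeakDerivatives

open Filter Topology

variable {V : Type*} [NormedAddCommGroup V] [NormedSpace ℝ V] [MeasureSpace V]

/-! The functional is convex, and quadratic in the derivatives. The parallelogram identity for the
quadratic part and the convexity of `s ↦ (max s 0) ^ γ` for `γ ≥ 1` give, with `q` the quadratic
part of the energy, `2 J((w + w')/2) + q(w - w')/2 ≤ J(w) + J(w')`
(`Rep.two_mul_J_midpoint_add_le`). Two functions whose energies are within `δ` of the infimum
therefore have `q(w - w') ≤ 4 δ`: their derivatives are close in `L²` with weight `e^{-t}`. Since `w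
- w'` has zero trace at `t = 0`, the Poincaré inequality `∫ e^{-2t} W² ≤ ∫ e^{-t} (∂ₜW)²`
(`lintegral_exp_sq_le`) makes the functions close as well.

This one estimate gives existence and uniqueness. A minimizing sequence is Cauchy in weighted `L²`
together with its derivatives, so it converges strongly, and almost everywhere if it is chosen to
converge fast. No weak compactness is needed: the limit stays in the class (`Rep.of_weighted_limit`)
and Fatou's lemma gives lower semicontinuity. With `δ = 0` two minimizers coincide.

The bound `C ε` comes from the competitor `u₀(x)`, constant in time: its time derivative vanishes,
and every remaining term carries a factor `ε`. For the sign, taking the positive part keeps the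
initial datum, since `u₀ ≥ 0`, and does not raise the energy; so the positive part of the minimizer
is a minimizer, and equals it by uniqueness.

The trace is handled through `initialExt`: extend `w` by `u₀(x)` to `t ≤ 0`. The trace is `u₀`
exactly when this extension has a weak time derivative on all of space-time, equal to that of `w` on
`Q` and to zero elsewhere. In this form the condition passes to midpoints, limits and positive parts
by the general rules for weak derivatives. -/

lemma setIntegral_mul_eq_integral {Ω : Set V} {ψ : V → ℝ} (h : tsupport ψ ⊆ Ω) (u : V → ℝ) :
    ∫ z in Ω, u z * ψ z = ∫ z, u z * ψ z :=
  setIntegral_eq_integral_of_forall_compl_eq_zero fun x hx => by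
    rw [image_eq_zero_of_notMem_tsupport fun hx' => hx (h hx'), mul_zero]

lemma tsupport_fderiv_apply_subset_tsupport {φ : V → ℝ} (e : V) :
    tsupport (fun z => fderiv ℝ φ z e) ⊆ tsupport φ :=
  tsupport_fderiv_apply_subset ℝ e

lemma IsTestFunction.mono {Ω Ω' : Set V} {φ : V → ℝ} (h : IsTestFunction Ω φ) (hΩ : Ω ⊆ Ω') :
    IsTestFunction Ω' φ :=
  ⟨h.smooth, h.compact, h.support_subset.trans hΩ⟩

lemma IsTestFunction.continuous_fderiv {Ω : Set V} {φ : V → ℝ} (h : IsTestFunction Ω φ) (e : V) :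
    Continuous fun z => fderiv ℝ φ z e :=
  (h.smooth.continuous_fderiv (by simp)).clm_apply continuous_const

lemma IsTestFunction.hasCompactSupport_fderiv {Ω : Set V} {φ : V → ℝ} (h : IsTestFunction Ω φ)
    (e : V) : HasCompactSupport fun z => fderiv ℝ φ z e :=
  h.compact.of_isClosed_subset (isClosed_tsupport _) (tsupport_fderiv_apply_subset_tsupport e)

lemma IsTestFunction.tsupport_fderiv {Ω : Set V} {φ : V → ℝ} (h : IsTestFunction Ω φ)
    (e : V) : tsupport (fun z => fderiv ℝ φ z e) ⊆ Ω :=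
  (tsupport_fderiv_apply_subset_tsupport e).trans h.support_subset

variable [BorelSpace V]

lemma integrable_mul_of_tsupport_subset {Ω : Set V} {u ψ : V → ℝ}
    (hu : LocallyIntegrableOn u Ω volume) (hψ : Continuous ψ) (hc : HasCompactSupport ψ)
    (h : tsupport ψ ⊆ Ω) : Integrable fun z => u z * ψ z := by
  have h1 : IntegrableOn (fun z => u z * ψ z) (tsupport ψ) :=
    (hu.integrableOn_compact_subset h hc).mul_continuousOn hψ.continuousOn hc
  refine (integrableOn_iff_integrable_of_support_subset ?_).1 h1
  exact (Function.support_mul_subset_right _ _).trans (subset_tsupport _)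

lemma HasWeakDeriv.integral_mul_fderiv {Ω : Set V} {u g φ : V → ℝ} {e : V}
    (h : HasWeakDeriv Ω u e g) (hφ : IsTestFunction Ω φ) :
    ∫ z, u z * fderiv ℝ φ z e = - ∫ z, g z * φ z := by
  rw [← setIntegral_mul_eq_integral (hφ.tsupport_fderiv e),
    ← setIntegral_mul_eq_integral hφ.support_subset, h.integral_eq φ hφ]

lemma HasWeakDeriv.of_integral {Ω : Set V} {u g : V → ℝ} {e : V}
    (hu : LocallyIntegrableOn u Ω volume) (hg : LocallyIntegrableOn g Ω volume)
    (h : ∀ φ, IsTestFunction Ω φ → ∫ z, u z * fderiv ℝ φ z e = - ∫ z, g z * φ z) :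
    HasWeakDeriv Ω u e g :=
  ⟨hu, hg, fun φ hφ => by
    rw [setIntegral_mul_eq_integral (hφ.tsupport_fderiv e),
    setIntegral_mul_eq_integral hφ.support_subset, h φ hφ]⟩

lemma HasWeakDeriv.integrable_mul_fderiv {Ω : Set V} {u g φ : V → ℝ} {e : V}
    (h : HasWeakDeriv Ω u e g) (hφ : IsTestFunction Ω φ) :
    Integrable fun z => u z * fderiv ℝ φ z e :=
  integrable_mul_of_tsupport_subset h.1 (hφ.continuous_fderiv e) (hφ.hasCompactSupport_fderiv e)
    (hφ.tsupport_fderiv e)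

lemma HasWeakDeriv.integrable_mul {Ω : Set V} {u g φ : V → ℝ} {e : V}
    (h : HasWeakDeriv Ω u e g) (hφ : IsTestFunction Ω φ) :
    Integrable fun z => g z * φ z :=
  integrable_mul_of_tsupport_subset h.2 hφ.smooth.continuous hφ.compact hφ.support_subset

lemma HasWeakDeriv.mono {Ω Ω' : Set V} {u g : V → ℝ} {e : V} (h : HasWeakDeriv Ω u e g)
    (hΩ : Ω' ⊆ Ω) : HasWeakDeriv Ω' u e g :=
  .of_integral (h.1.mono_set hΩ) (h.2.mono_set hΩ)
    fun _ hφ => h.integral_mul_fderiv (hφ.mono hΩ)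

lemma HasWeakDeriv.congr_ae {Ω : Set V} {u g u' g' : V → ℝ} {e : V} (h : HasWeakDeriv Ω u e g)
    (hu : u =ᵐ[volume.restrict Ω] u') (hg : g =ᵐ[volume.restrict Ω] g') :
    HasWeakDeriv Ω u' e g' :=
  ⟨h.1.congr hu, h.2.congr hg, fun φ hφ => by
    have h1 : ∫ z in Ω, u z * fderiv ℝ φ z e = ∫ z in Ω, u' z * fderiv ℝ φ z e :=
      integral_congr_ae (hu.mono fun z hz => by simp only [hz])
    have h2 : ∫ z in Ω, g z * φ z = ∫ z in Ω, g' z * φ z :=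
      integral_congr_ae (hg.mono fun z hz => by simp only [hz])
    rw [← h1, ← h2, h.3 φ hφ]⟩

lemma HasWeakDeriv.add {Ω : Set V} {u g u' g' : V → ℝ} {e : V} (h : HasWeakDeriv Ω u e g)
    (h' : HasWeakDeriv Ω u' e g') :
    HasWeakDeriv Ω (fun z => u z + u' z) e (fun z => g z + g' z) :=
  .of_integral (h.1.add h'.1) (h.2.add h'.2) fun φ hφ => by
    simp only [add_mul]
    rw [integral_add (h.integrable_mul_fderiv hφ) (h'.integrable_mul_fderiv hφ),
      integral_add (h.integrable_mul hφ) (h'.integrable_mul hφ), h.integral_mul_fderiv hφ,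
      h'.integral_mul_fderiv hφ, neg_add]

lemma HasWeakDeriv.const_mul {Ω : Set V} {u g : V → ℝ} {e : V} (h : HasWeakDeriv Ω u e g)
    (c : ℝ) : HasWeakDeriv Ω (fun z => c * u z) e (fun z => c * g z) :=
  .of_integral (h.1.smul c) (h.2.smul c) fun φ hφ => by
    simp only [mul_assoc]
    rw [integral_const_mul, integral_const_mul, h.integral_mul_fderiv hφ, mul_neg]

lemma HasWeakDeriv.sub {Ω : Set V} {u g u' g' : V → ℝ} {e : V} (h : HasWeakDeriv Ω u e g)
    (h' : HasWeakDeriv Ω u' e g') :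
    HasWeakDeriv Ω (fun z => u z - u' z) e (fun z => g z - g' z) := by
  simpa [sub_eq_add_neg] using h.add (h'.const_mul (-1))

lemma HasWeakDeriv.add_dir {Ω : Set V} {u g g' : V → ℝ} {e e' : V} (h : HasWeakDeriv Ω u e g)
    (h' : HasWeakDeriv Ω u e' g') : HasWeakDeriv Ω u (e + e') (fun z => g z + g' z) :=
  .of_integral h.1 (h.2.add h'.2) fun φ hφ => by
    simp only [add_mul, map_add, mul_add]
    rw [integral_add (h.integrable_mul_fderiv hφ) (h'.integrable_mul_fderiv hφ),
      integral_add (h.integrable_mul hφ) (h'.integrable_mul hφ), h.integral_mul_fderiv hφ,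
      h'.integral_mul_fderiv hφ, neg_add]

lemma HasWeakDeriv.smul_dir {Ω : Set V} {u g : V → ℝ} {e : V} (h : HasWeakDeriv Ω u e g)
    (c : ℝ) : HasWeakDeriv Ω u (c • e) (fun z => c * g z) :=
  .of_integral h.1 (h.2.smul c) fun φ hφ => by
    simp only [mul_assoc, map_smul, smul_eq_mul, mul_left_comm _ c]
    rw [integral_const_mul, integral_const_mul, h.integral_mul_fderiv hφ, mul_neg]

lemma HasWeakDeriv.zero_dir {Ω : Set V} {u : V → ℝ} (h : LocallyIntegrableOn u Ω volume) :
    HasWeakDeriv Ω u 0 0 :=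
  .of_integral h locallyIntegrableOn_zero fun φ _ => by simp

lemma HasWeakDeriv.sum_dir {ι : Type*} {Ω : Set V} {u : V → ℝ}
    (hu : LocallyIntegrableOn u Ω volume) {e : ι → V}
    {g : ι → V → ℝ} (s : Finset ι) (h : ∀ i ∈ s, HasWeakDeriv Ω u (e i) (g i)) :
    HasWeakDeriv Ω u (∑ i ∈ s, e i) (fun z => ∑ i ∈ s, g i z) := by
  classical
  induction s using Finset.induction_on with
  | empty => simpa using! HasWeakDeriv.zero_dir hu
  | insert a s ha ih =>
    simp only [Finset.sum_insert ha]
    exact (h a (by simp)).add_dir (ih fun i hi => h i (by simp [hi]))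

/-- Weak derivatives pass to limits tested against continuous compactly supported functions. -/
lemma HasWeakDeriv.of_tendsto {Ω : Set V} {u g : V → ℝ} {e : V} {u' g' : ℕ → V → ℝ}
    (h : ∀ k, HasWeakDeriv Ω (u' k) e (g' k))
    (hu : LocallyIntegrableOn u Ω volume) (hg : LocallyIntegrableOn g Ω volume)
    (hu' : ∀ ψ : V → ℝ, Continuous ψ → HasCompactSupport ψ → tsupport ψ ⊆ Ω →
      Tendsto (fun k => ∫ z, u' k z * ψ z) atTop (𝓝 (∫ z, u z * ψ z)))
    (hg' : ∀ ψ : V → ℝ, Continuous ψ → HasCompactSupport ψ → tsupport ψ ⊆ Ω →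
      Tendsto (fun k => ∫ z, g' k z * ψ z) atTop (𝓝 (∫ z, g z * ψ z))) :
    HasWeakDeriv Ω u e g :=
  .of_integral hu hg fun φ hφ => by
    have h1 := hu' _ (hφ.continuous_fderiv e) (hφ.hasCompactSupport_fderiv e)
      (hφ.tsupport_fderiv e)
    have h2 := (hg' _ hφ.smooth.continuous hφ.compact hφ.support_subset).neg
    refine tendsto_nhds_unique h1 (h2.congr fun k => ?_)
    rw [(h k).integral_mul_fderiv hφ]

variable [FiniteDimensional ℝ V]

lemma ae_restrict_eq_of_integral_mul_eq {Ω : Set V} (hΩ : IsOpen Ω) {g g' : V → ℝ}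
    (hg : LocallyIntegrableOn g Ω volume) (hg' : LocallyIntegrableOn g' Ω volume)
    (h : ∀ φ, IsTestFunction Ω φ → ∫ z, g z * φ z = ∫ z, g' z * φ z) :
    g =ᵐ[volume.restrict Ω] g' := by
  have := hΩ.ae_eq_zero_of_integral_contDiff_smul_eq_zero (μ := volume) (f := g - g')
    (hg.sub hg') (fun φ h1 h2 h3 => by
      have h4 := h φ ⟨h1, h2, h3⟩
      simp only [Pi.sub_apply, smul_eq_mul, mul_comm (φ _), sub_mul]
      rw [integral_sub, h4, sub_self]
      · exact integrable_mul_of_tsupport_subset hg h1.continuous h2 h3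
      · exact integrable_mul_of_tsupport_subset hg' h1.continuous h2 h3)
  rw [Filter.EventuallyEq, ae_restrict_iff' hΩ.measurableSet]
  filter_upwards [this] with z hz hzΩ using sub_eq_zero.1 (hz hzΩ)

lemma HasWeakDeriv.ae_eq {Ω : Set V} (hΩ : IsOpen Ω) {u g g' : V → ℝ} {e : V}
    (h : HasWeakDeriv Ω u e g) (h' : HasWeakDeriv Ω u e g') : g =ᵐ[volume.restrict Ω] g' :=
  ae_restrict_eq_of_integral_mul_eq hΩ h.2 h'.2 fun φ hφ => by
    rw [← neg_inj, ← h.integral_mul_fderiv hφ, h'.integral_mul_fderiv hφ]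

lemma HasWeakDeriv.weakDeriv {Ω : Set V} {u g : V → ℝ} {e : V}
    (h : HasWeakDeriv Ω u e g) : HasWeakDeriv Ω u e (weakDeriv Ω u e) := by
  have h' : ∃ g, HasWeakDeriv Ω u e g := ⟨g, h⟩
  rw [ParabolicMin.weakDeriv, dif_pos h']
  exact h'.choose_spec

/-- Allows any convenient representative to replace the one picked by choice in the functional and
in the trace condition. -/
lemma HasWeakDeriv.weakDeriv_ae_eq {Ω : Set V} (hΩ : IsOpen Ω) {u g : V → ℝ} {e : V}
    (h : HasWeakDeriv Ω u e g) : ParabolicMin.weakDeriv Ω u e =ᵐ[volume.restrict Ω] g :=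
  h.weakDeriv.ae_eq hΩ h

end WeakDerivatives

/-! ### Smooth approximation by mollification -/

section Mollification

open Filter Topology
open scoped Convolution

variable {V : Type*} [NormedAddCommGroup V] [NormedSpace ℝ V] [MeasureSpace V] [BorelSpace V]
  [FiniteDimensional ℝ V] [(volume : Measure V).IsAddHaarMeasure]

/-- Translations act continuously on `L¹`. -/
lemma tendsto_lintegral_translate_sub {f : V → ℝ} (hf : Integrable f) :
    Tendsto (fun y => ∫⁻ x, ‖f (x - y) - f x‖ₑ) (𝓝 0) (𝓝 0) := by
  let τ : C(V, C(V, V)) := (ContinuousMap.mk (fun p : V × V => p.2 - p.1) (by fun_prop)).curry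
  have hτ : ∀ y, MeasurePreserving (τ y) (volume : Measure V) volume := fun y =>
    measurePreserving_sub_right volume y
  have hF := Tendsto.compMeasurePreservingLp (μ := (volume : Measure V)) (ν := volume) (p := 1)
    (l := 𝓝 (0 : V)) (f := fun _ => hf.toL1 f) tendsto_const_nhds (τ.continuous.tendsto 0) hτ (hτ 0)
    (by simp)
  rw [tendsto_iff_edist_tendsto_0] at hF
  refine hF.congr fun y => ?_
  rw [Lp.edist_def, eLpNorm_one_eq_lintegral_enorm]
  refine lintegral_congr_ae ?_
  have hc : ∀ y, (Lp.compMeasurePreserving (τ y) (hτ y) (hf.toL1 f) : V → ℝ) =ᵐ[volume]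
      fun x => f (x - y) := fun y =>
    (Lp.coeFn_compMeasurePreserving _ (hτ y)).trans
      ((hτ y).quasiMeasurePreserving.ae_eq_comp hf.coeFn_toL1)
  filter_upwards [hc y, hc 0] with x h1 h2
  simp only [Pi.sub_apply, h1, h2, sub_zero]

/-- Since `ρ` has mass one, `f ⋆ ρ - f` is the `ρ`-average of the differences `f (· - y) - f`;
Tonelli then moves the `L¹` norm inside the average. -/
lemma lintegral_enorm_convolution_sub_le {f ρ : V → ℝ} (hf : Integrable f) (hρ : Continuous ρ)
    (hc : HasCompactSupport ρ) (h0 : ∀ y, 0 ≤ ρ y) (h1 : ∫ y, ρ y = 1) {η : ℝ≥0∞}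
    (hη : ∀ y ∈ Function.support ρ, ∫⁻ x, ‖f (x - y) - f x‖ₑ ≤ η) :
    ∫⁻ x, ‖(f ⋆[ContinuousLinearMap.mul ℝ ℝ, volume] ρ) x - f x‖ₑ ≤ η := by
  have hρi : Integrable ρ := hρ.integrable_of_hasCompactSupport hc
  have hρ1 : ∫⁻ y, ‖ρ y‖ₑ = 1 := by
    rw [← ofReal_integral_norm_eq_lintegral_enorm hρi]
    simp only [Real.norm_of_nonneg (h0 _), h1, ENNReal.ofReal_one]
  have key : ∀ x, ‖(f ⋆[ContinuousLinearMap.mul ℝ ℝ, volume] ρ) x - f x‖ₑ ≤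
      ∫⁻ y, ‖ρ y‖ₑ * ‖f (x - y) - f x‖ₑ := by
    intro x
    have hex := (hc.convolutionExists_right (ContinuousLinearMap.mul ℝ ℝ) hf.locallyIntegrable hρ
      x).integrable_swap
    have : (f ⋆[ContinuousLinearMap.mul ℝ ℝ, volume] ρ) x - f x =
        ∫ y, ρ y * (f (x - y) - f x) := by
      rw [convolution_eq_swap]
      simp only [ContinuousLinearMap.mul_apply', mul_comm (ρ _), sub_mul]
      rw [integral_sub, integral_const_mul, h1, mul_one]
      · exact hex
      · exact hρi.const_mul _
    rw [this]
    refine (enorm_integral_le_lintegral_enorm _).trans_eq ?_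
    simp only [enorm_mul]
  calc _ ≤ ∫⁻ x, ∫⁻ y, ‖ρ y‖ₑ * ‖f (x - y) - f x‖ₑ := lintegral_mono key
    _ = ∫⁻ y, ∫⁻ x, ‖ρ y‖ₑ * ‖f (x - y) - f x‖ₑ := by
        refine lintegral_lintegral_swap ?_
        have e1 : AEStronglyMeasurable (fun p : V × V => f (p.1 - p.2))
            ((volume : Measure V).prod volume) :=
          hf.aestronglyMeasurable.comp_quasiMeasurePreserving
            (quasiMeasurePreserving_sub_of_right_invariant volume volume)
        have e2 : AEStronglyMeasurable (fun p : V × V => f p.1)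
            ((volume : Measure V).prod volume) := hf.aestronglyMeasurable.comp_fst
        have e3 : AEStronglyMeasurable (fun p : V × V => ρ p.2)
            ((volume : Measure V).prod volume) := (hρ.comp continuous_snd).aestronglyMeasurable
        exact e3.enorm.mul (e1.sub e2).enorm
    _ ≤ ∫⁻ y, ‖ρ y‖ₑ * η := by
        refine lintegral_mono fun y => ?_
        rw [lintegral_const_mul' _ _ (by simp)]
        by_cases hy : ρ y = 0
        · simp [hy]
        · gcongr
          exact hη y hy
    _ = η := by
      rw [lintegral_mul_const'' _ hρ.aestronglyMeasurable.enorm, hρ1, one_mul]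

/-- Mollify `u` cut off to a compact thickening `K'` of `K` inside `Ω`. The cutoff creates no error
on `K`: there a kernel of radius at most the thickening width sees only points of `K'`, so the
derivative of the mollification is the mollification of `g`. -/
lemma HasWeakDeriv.exists_smooth_approx_le {Ω K : Set V} (hΩ : IsOpen Ω) (hK : IsCompact K)
    (hKΩ : K ⊆ Ω) {u g : V → ℝ} {e : V} (h : HasWeakDeriv Ω u e g) {η : ℝ≥0∞} (hη : 0 < η) :
    ∃ w : V → ℝ, ContDiff ℝ ∞ w ∧ ∫⁻ z in K, ‖w z - u z‖ₑ ≤ η ∧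
      ∫⁻ z in K, ‖fderiv ℝ w z e - g z‖ₑ ≤ η := by
  obtain ⟨δ, hδ, hδΩ⟩ := hK.exists_cthickening_subset_open hΩ hKΩ
  set K' := Metric.cthickening δ K with hK'
  have hK'c : IsCompact K' := hK.cthickening
  have hKK' : K ⊆ K' := Metric.self_subset_cthickening K
  have hu : Integrable (K'.indicator u) :=
    (h.1.integrableOn_compact_subset hδΩ hK'c).integrable_indicator hK'c.measurableSet
  have hg : Integrable (K'.indicator g) :=
    (h.2.integrableOn_compact_subset hδΩ hK'c).integrable_indicator hK'c.measurableSet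
  have ev : ∀ᶠ y in 𝓝 (0 : V),
      (∫⁻ x, ‖K'.indicator u (x - y) - K'.indicator u x‖ₑ ≤ η) ∧
      (∫⁻ x, ‖K'.indicator g (x - y) - K'.indicator g x‖ₑ ≤ η) :=
    ((tendsto_lintegral_translate_sub hu).eventually (ge_mem_nhds hη)).and
      ((tendsto_lintegral_translate_sub hg).eventually (ge_mem_nhds hη))
  obtain ⟨r, hr, hrball⟩ := Metric.eventually_nhds_iff_ball.1 ev
  let φ : ContDiffBump (0 : V) := ⟨min r δ / 2, min r δ, by positivity, by
    have : 0 < min r δ := by positivity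
    linarith⟩
  set ρ : V → ℝ := φ.normed volume with hρdef
  have hρs : Function.support ρ = Metric.ball 0 (min r δ) := φ.support_normed_eq
  have hρc : HasCompactSupport ρ := φ.hasCompactSupport_normed
  have hρ : ContDiff ℝ ∞ ρ := φ.contDiff_normed
  have conv : ∀ f : V → ℝ, Integrable f → (∀ y ∈ Metric.ball (0 : V) r,
      ∫⁻ x, ‖f (x - y) - f x‖ₑ ≤ η) →
      ∫⁻ x, ‖(f ⋆[ContinuousLinearMap.mul ℝ ℝ, volume] ρ) x - f x‖ₑ ≤ η := by
    intro f hf hfr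
    refine lintegral_enorm_convolution_sub_le hf hρ.continuous hρc φ.nonneg_normed
      φ.integral_normed fun y hy => hfr y ?_
    rw [hρs] at hy
    exact Metric.ball_subset_ball (min_le_left _ _) hy
  have restr : ∀ f F : V → ℝ, (∀ x ∈ K, f x = F x) → ∀ f' : V → ℝ,
      ∫⁻ x, ‖F x - K'.indicator f' x‖ₑ ≤ η → ∫⁻ x in K, ‖f x - f' x‖ₑ ≤ η := by
    intro f F hfF f' hle
    refine le_trans ?_ hle
    refine le_trans (le_of_eq ?_) (setLIntegral_le_lintegral K _)
    refine setLIntegral_congr_fun hK.measurableSet fun x hx => ?_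
    simp only [hfF x hx, indicator_of_mem (hKK' hx)]
  refine ⟨K'.indicator u ⋆[ContinuousLinearMap.mul ℝ ℝ, volume] ρ, ?_, ?_, ?_⟩
  · exact hρc.contDiff_convolution_right _ hu.locallyIntegrable hρ
  · exact restr _ _ (fun _ _ => rfl) _ (conv _ hu fun y hy => (hrball y hy).1)
  · refine restr _ _ (fun x hx => ?_) _ (conv _ hg fun y hy => (hrball y hy).2)
    rw [(hρc.hasFDerivAt_convolution_right (ContinuousLinearMap.mul ℝ ℝ) hu.locallyIntegrable
      (hρ.of_le (by simp)) x).fderiv, convolution_precompR_apply _ hu.locallyIntegrable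
      (hρc.fderiv ℝ) (hρ.continuous_fderiv (by simp))]
    have hsub : ∀ t, t ∉ K' → x - t ∉ tsupport ρ := by
      intro t ht hxt
      rw [hρdef, φ.tsupport_normed_eq, mem_closedBall_zero_iff] at hxt
      refine ht (Metric.mem_cthickening_of_dist_le t x δ K hx ?_)
      rw [dist_comm, dist_eq_norm]
      exact hxt.trans (min_le_right _ _)
    -- Testing the weak derivative against the reflected kernel `ρ (x - ·)` transfers the derivative
    -- from `ρ` to `u`; the sign from the reflection cancels the one from the integration by parts.
    have htest : IsTestFunction Ω (fun t => ρ (x - t)) := by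
      have hts : tsupport (fun t => ρ (x - t)) ⊆ K' := by
        refine closure_minimal (fun t ht => ?_) hK'c.isClosed
        by_contra htK
        exact ht (image_eq_zero_of_notMem_tsupport (hsub t htK))
      exact ⟨hρ.comp (contDiff_const.sub contDiff_id),
        hK'c.of_isClosed_subset (isClosed_tsupport _) hts, hts.trans hδΩ⟩
    have hfd : ∀ t, fderiv ℝ (fun t => ρ (x - t)) t e = - fderiv ℝ ρ (x - t) e := by
      intro t
      have hd : HasFDerivAt ρ (fderiv ℝ ρ (x - t)) (x - t) :=
        (hρ.differentiable (by simp)).differentiableAt.hasFDerivAt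
      have hs : HasFDerivAt (fun t => x - t) (-ContinuousLinearMap.id ℝ V) t := by
        simpa using (hasFDerivAt_id t).const_sub x
      rw [HasFDerivAt.fderiv (f := fun t => ρ (x - t)) (hd.comp t hs)]
      simp
    have hI := h.integral_mul_fderiv htest
    simp only [hfd, mul_neg, integral_neg, neg_inj] at hI
    simp only [convolution_def, ContinuousLinearMap.mul_apply']
    have e1 : ∀ t, K'.indicator u t * fderiv ℝ ρ (x - t) e = u t * fderiv ℝ ρ (x - t) e := by
      intro t
      by_cases ht : t ∈ K'
      · rw [indicator_of_mem ht]
      · rw [image_eq_zero_of_notMem_tsupport (f := fun z => fderiv ℝ ρ z e)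
          (fun h' => hsub t ht (tsupport_fderiv_apply_subset_tsupport e h')), mul_zero, mul_zero]
    have e2 : ∀ t, K'.indicator g t * ρ (x - t) = g t * ρ (x - t) := by
      intro t
      by_cases ht : t ∈ K'
      · rw [indicator_of_mem ht]
      · rw [image_eq_zero_of_notMem_tsupport (hsub t ht), mul_zero, mul_zero]
    simp only [e1, e2, hI]

/-- Local approximation of a function with a weak derivative by smooth functions. -/
lemma HasWeakDeriv.exists_smooth_approx {Ω K : Set V} (hΩ : IsOpen Ω) (hK : IsCompact K)
    (hKΩ : K ⊆ Ω) {u g : V → ℝ} {e : V} (h : HasWeakDeriv Ω u e g) :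
    ∃ w : ℕ → V → ℝ, (∀ k, ContDiff ℝ ∞ (w k)) ∧
      Tendsto (fun k => ∫⁻ z in K, ‖w k z - u z‖ₑ) atTop (𝓝 0) ∧
      Tendsto (fun k => ∫⁻ z in K, ‖fderiv ℝ (w k) z e - g z‖ₑ) atTop (𝓝 0) := by
  have hη : ∀ k : ℕ, (0 : ℝ≥0∞) < (k : ℝ≥0∞)⁻¹ := fun k => by simp
  choose w h1 h2 h3 using fun k : ℕ => h.exists_smooth_approx_le hΩ hK hKΩ (hη k)
  exact ⟨w, h1, tendsto_of_tendsto_of_tendsto_of_le_of_le tendsto_const_nhds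
    ENNReal.tendsto_inv_nat_nhds_zero (fun _ => zero_le) h2,
    tendsto_of_tendsto_of_tendsto_of_le_of_le tendsto_const_nhds
    ENNReal.tendsto_inv_nat_nhds_zero (fun _ => zero_le) h3⟩

end Mollification

/-! ### Chain rule and positive parts -/

section ChainRule

open Filter Topology

variable {V : Type*} [NormedAddCommGroup V] [NormedSpace ℝ V] [MeasureSpace V] [BorelSpace V]
  [FiniteDimensional ℝ V] [(volume : Measure V).IsAddHaarMeasure]

lemma abs_sub_le_of_hasDerivAt {F θ : ℝ → ℝ} (hF : ∀ s, HasDerivAt F (θ s) s)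
    (hθ1 : ∀ s, |θ s| ≤ 1) (a b : ℝ) : |F a - F b| ≤ |a - b| := by
  have := convex_univ.norm_image_sub_le_of_norm_hasDerivWithin_le (f := F) (f' := θ) (C := 1)
    (fun x _ => (hF x).hasDerivWithinAt) (fun x _ => hθ1 x) (mem_univ b) (mem_univ a)
  simpa using this

lemma LocallyIntegrableOn.mono_aestronglyMeasurable_restrict {Ω : Set V} {f g : V → ℝ}
    (hg : LocallyIntegrableOn g Ω volume) (hf : AEStronglyMeasurable f (volume.restrict Ω))
    (hle : ∀ z, ‖f z‖ ≤ ‖g z‖) : LocallyIntegrableOn f Ω volume := by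
  intro x hx
  obtain ⟨s, hs, hgs⟩ := hg x hx
  exact ⟨s ∩ Ω, inter_mem hs self_mem_nhdsWithin, Integrable.mono (hgs.mono_set inter_subset_left)
    (hf.mono_set inter_subset_right) (Eventually.of_forall hle)⟩

lemma LocallyIntegrableOn.comp_of_abs_le {Ω : Set V} {u : V → ℝ} {F : ℝ → ℝ}
    (hu : LocallyIntegrableOn u Ω volume) (hF : Measurable F) {c : ℝ}
    (hle : ∀ s, |F s| ≤ |s| + c) : LocallyIntegrableOn (fun z => F (u z)) Ω volume := by
  refine LocallyIntegrableOn.mono_aestronglyMeasurable_restrict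
    (hu.norm.add (locallyIntegrableOn_const c))
    (hF.comp_aemeasurable hu.aestronglyMeasurable.aemeasurable).aestronglyMeasurable fun z => ?_
  have h := hle (u z)
  simp only [Real.norm_eq_abs, Pi.add_apply]
  exact h.trans (le_abs_self _)

lemma LocallyIntegrableOn.bdd_mul_comp {Ω : Set V} {u g : V → ℝ} {θ : ℝ → ℝ}
    (hu : LocallyIntegrableOn u Ω volume)
    (hg : LocallyIntegrableOn g Ω volume) (hθ : Measurable θ) (hθ1 : ∀ s, |θ s| ≤ 1) :
    LocallyIntegrableOn (fun z => θ (u z) * g z) Ω volume := by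
  refine LocallyIntegrableOn.mono_aestronglyMeasurable_restrict hg
    ((hθ.comp_aemeasurable hu.aestronglyMeasurable.aemeasurable).mul
    hg.aestronglyMeasurable.aemeasurable).aestronglyMeasurable fun z => ?_
  rw [norm_mul]
  exact mul_le_of_le_one_left (norm_nonneg _) (hθ1 _)

/-- Chain rule for a `C¹` function with bounded derivative. -/
lemma HasWeakDeriv.comp_hasDerivAt {Ω : Set V} (hΩ : IsOpen Ω) {u g : V → ℝ} {e : V}
    (h : HasWeakDeriv Ω u e g) {F θ : ℝ → ℝ} (hF : ∀ s, HasDerivAt F (θ s) s)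
    (hθ : Continuous θ) (hθ1 : ∀ s, |θ s| ≤ 1) :
    HasWeakDeriv Ω (fun z => F (u z)) e (fun z => θ (u z) * g z) := by
  have hLip := abs_sub_le_of_hasDerivAt hF hθ1
  have hFc : Continuous F := continuous_iff_continuousAt.2 fun s => (hF s).continuousAt
  have hFu : LocallyIntegrableOn (fun z => F (u z)) Ω volume := by
    refine LocallyIntegrableOn.comp_of_abs_le (c := |F 0|) h.1
      hFc.measurable fun s => ?_
    have := hLip s 0
    rw [sub_zero] at this
    linarith [abs_sub_abs_le_abs_sub (F s) (F 0)]
  have hθg := LocallyIntegrableOn.bdd_mul_comp h.1 h.2 hθ.measurable hθ1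
  refine .of_integral hFu hθg fun φ hφ => ?_
  set K := tsupport φ with hKdef
  have hK : IsCompact K := hφ.compact
  obtain ⟨w, hw, hw0, hw1⟩ := h.exists_smooth_approx hΩ hK hφ.support_subset
  have huK : IntegrableOn u K := h.1.integrableOn_compact_subset hφ.support_subset hK
  have hgK : IntegrableOn g K := h.2.integrableOn_compact_subset hφ.support_subset hK
  -- As `θ` is only continuous, the convergence of `θ (w k)` needs pointwise convergence of `w k`,
  -- available along a subsequence.
  obtain ⟨ns, hns, hae⟩ : ∃ ns : ℕ → ℕ, StrictMono ns ∧
      ∀ᵐ z ∂(volume.restrict K), Tendsto (fun k => w (ns k) z) atTop (𝓝 (u z)) := by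
    refine TendstoInMeasure.exists_seq_tendsto_ae (tendstoInMeasure_of_tendsto_eLpNorm
      (p := 1) (by simp) (fun k => (hw k).continuous.aestronglyMeasurable)
      huK.aestronglyMeasurable ?_)
    simpa only [eLpNorm_one_eq_lintegral_enorm, Pi.sub_apply] using hw0
  have hn : Tendsto ns atTop atTop := hns.tendsto_atTop
  obtain ⟨C, hC⟩ : ∃ C : ℝ, ∀ z, ‖φ z‖ ≤ C :=
    hφ.smooth.continuous.bounded_above_of_compact_support hφ.compact
  obtain ⟨C', hC'⟩ : ∃ C : ℝ, ∀ z, ‖fderiv ℝ φ z e‖ ≤ C :=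
    (hφ.continuous_fderiv e).bounded_above_of_compact_support (hφ.hasCompactSupport_fderiv e)
  have hCe : ∀ z, ‖φ z‖ₑ ≤ ENNReal.ofReal C := fun z => by
    rw [← ofReal_norm]; exact ENNReal.ofReal_le_ofReal (hC z)
  have hCe' : ∀ z, ‖fderiv ℝ φ z e‖ₑ ≤ ENNReal.ofReal C' := fun z => by
    rw [← ofReal_norm]; exact ENNReal.ofReal_le_ofReal (hC' z)
  have hcw : ∀ k, Continuous fun z => fderiv ℝ (w k) z e := fun k =>
    ((hw k).continuous_fderiv (by simp)).clm_apply continuous_const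
  have classical : ∀ k, ∫ z in K, F (w k z) * fderiv ℝ φ z e =
      - ∫ z in K, θ (w k z) * fderiv ℝ (w k) z e * φ z := by
    intro k
    have hwd : Differentiable ℝ (w k) := (hw k).differentiable (by simp)
    have hd : ∀ z, HasFDerivAt (fun z => F (w k z)) (θ (w k z) • fderiv ℝ (w k) z) z :=
      fun z => (hF (w k z)).comp_hasFDerivAt z (hwd z).hasFDerivAt
    have hfd : ∀ z, fderiv ℝ (fun z => F (w k z)) z e = θ (w k z) * fderiv ℝ (w k) z e := by
      intro z
      rw [(hd z).fderiv]
      rfl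
    have hcF : Continuous fun z => F (w k z) := hFc.comp (hw k).continuous
    have hcθ : Continuous fun z => θ (w k z) * fderiv ℝ (w k) z e :=
      (hθ.comp (hw k).continuous).mul (hcw k)
    rw [setIntegral_mul_eq_integral (tsupport_fderiv_apply_subset_tsupport e),
      setIntegral_mul_eq_integral subset_rfl]
    simp only [← hfd]
    refine integral_mul_fderiv_eq_neg_fderiv_mul_of_integrable ?_ ?_ ?_
      (fun z _ => (hd z).differentiableAt) fun z _ => hφ.smooth.differentiable (by simp) z
    · simp only [hfd]
      exact (hcθ.mul hφ.smooth.continuous).integrable_of_hasCompactSupport hφ.compact.mul_left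
    · exact (hcF.mul (hφ.continuous_fderiv e)).integrable_of_hasCompactSupport
        (hφ.hasCompactSupport_fderiv e).mul_left
    · exact (hcF.mul hφ.smooth.continuous).integrable_of_hasCompactSupport hφ.compact.mul_left
  have lim1 : Tendsto (fun k => ∫ z in K, F (w (ns k) z) * fderiv ℝ φ z e) atTop
      (𝓝 (∫ z in K, F (u z) * fderiv ℝ φ z e)) := by
    refine tendsto_integral_of_L1 _ ?_ (Eventually.of_forall fun k => ?_) ?_
    · exact (integrable_mul_of_tsupport_subset hFu (hφ.continuous_fderiv e)
        (hφ.hasCompactSupport_fderiv e) (hφ.tsupport_fderiv e)).aestronglyMeasurable.restrict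
    · exact (((hFc.comp (hw (ns k)).continuous).mul
        (hφ.continuous_fderiv e)).integrable_of_hasCompactSupport
        (hφ.hasCompactSupport_fderiv e).mul_left).integrableOn
    · have hz : Tendsto (fun k => ENNReal.ofReal C' * ∫⁻ z in K, ‖w (ns k) z - u z‖ₑ) atTop
          (𝓝 0) := by
        have := ENNReal.Tendsto.const_mul (a := ENNReal.ofReal C') (hw0.comp hn)
          (Or.inr (by simp))
        simpa using this
      refine tendsto_of_tendsto_of_tendsto_of_le_of_le tendsto_const_nhds hz
        (fun _ => zero_le) fun k => ?_
      dsimp only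
      rw [← lintegral_const_mul' _ _ (by simp)]
      refine lintegral_mono fun z => ?_
      rw [← sub_mul, enorm_mul, mul_comm]
      refine mul_le_mul' (hCe' z) ?_
      exact enorm_le_iff_norm_le.2 (hLip _ _)
  have lim2 : Tendsto (fun k => ∫ z in K, θ (w (ns k) z) * fderiv ℝ (w (ns k)) z e * φ z) atTop
      (𝓝 (∫ z in K, θ (u z) * g z * φ z)) := by
    have hgφ : IntegrableOn (fun z => g z * φ z) K := (h.integrable_mul hφ).integrableOn
    refine tendsto_integral_of_L1 _ ?_ (Eventually.of_forall fun k => ?_) ?_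
    · exact (integrable_mul_of_tsupport_subset hθg hφ.smooth.continuous hφ.compact
        hφ.support_subset).aestronglyMeasurable.restrict
    · exact ((((hθ.comp (hw (ns k)).continuous).mul (hcw (ns k))).mul
        hφ.smooth.continuous).integrable_of_hasCompactSupport hφ.compact.mul_left).integrableOn
    · have hz : Tendsto (fun k => ENNReal.ofReal C *
          ∫⁻ z in K, ‖fderiv ℝ (w (ns k)) z e - g z‖ₑ) atTop (𝓝 0) := by
        have := ENNReal.Tendsto.const_mul (a := ENNReal.ofReal C) (hw1.comp hn)
          (Or.inr (by simp))
        simpa using this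
      -- The factor `θ (w k) - θ (u)` tends to zero only pointwise; it is bounded by 2, so dominated
      -- convergence applies with bound `2 |g φ|`.
      have hz2 : Tendsto (fun k => ∫⁻ z in K, ‖(θ (w (ns k) z) - θ (u z)) * (g z * φ z)‖ₑ)
          atTop (𝓝 0) := by
        have hle : ∀ k z, ‖(θ (w (ns k) z) - θ (u z)) * (g z * φ z)‖ₑ ≤
            2 * ‖g z * φ z‖ₑ := by
          intro k z
          rw [enorm_mul]
          gcongr
          rw [← ofReal_norm, ← ENNReal.ofReal_ofNat]
          refine ENNReal.ofReal_le_ofReal ((norm_sub_le _ _).trans ?_)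
          have h1 := hθ1 (w (ns k) z)
          have h2 := hθ1 (u z)
          simp only [Real.norm_eq_abs]
          linarith
        have := tendsto_lintegral_of_dominated_convergence' (μ := volume.restrict K)
          (f := fun _ => 0) (fun z => 2 * ‖g z * φ z‖ₑ) (fun k => ?_)
          (fun k => Eventually.of_forall (hle k)) ?_ ?_
        · simpa using this
        · exact ((((hθ.comp (hw (ns k)).continuous).aestronglyMeasurable.sub
            (hθ.comp_aestronglyMeasurable huK.aestronglyMeasurable)).mul
            hgφ.aestronglyMeasurable).enorm)
        · rw [lintegral_const_mul' _ _ (by simp)]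
          exact ENNReal.mul_ne_top (by simp) hgφ.2.ne
        · filter_upwards [hae] with z hz
          have h1 : Tendsto (fun k => (θ (w (ns k) z) - θ (u z)) * (g z * φ z)) atTop (𝓝 0) := by
            have := (((hθ.tendsto (u z)).comp hz).sub_const (θ (u z))).mul_const (g z * φ z)
            simpa using this
          simpa using h1.enorm
      have hz3 := hz.add hz2
      rw [add_zero] at hz3
      refine tendsto_of_tendsto_of_tendsto_of_le_of_le tendsto_const_nhds hz3
        (fun _ => zero_le) fun k => ?_
      dsimp only
      rw [← lintegral_const_mul' _ _ (by simp), ← lintegral_add_left' ?_]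
      · refine lintegral_mono fun z => ?_
        have : θ (w (ns k) z) * fderiv ℝ (w (ns k)) z e * φ z - θ (u z) * g z * φ z =
            φ z * (θ (w (ns k) z) * (fderiv ℝ (w (ns k)) z e - g z)) +
              (θ (w (ns k) z) - θ (u z)) * (g z * φ z) := by ring
        rw [this]
        refine (enorm_add_le _ _).trans (add_le_add ?_ le_rfl)
        rw [enorm_mul]
        refine mul_le_mul' (hCe z) (enorm_le_iff_norm_le.2 ?_)
        rw [norm_mul]
        exact mul_le_of_le_one_left (norm_nonneg _) (hθ1 _)
      · exact ((hcw (ns k)).aestronglyMeasurable.sub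
          hgK.aestronglyMeasurable).enorm.const_mul _
  have := tendsto_nhds_unique (lim1.congr fun k => classical (ns k)) lim2.neg
  rwa [setIntegral_mul_eq_integral (tsupport_fderiv_apply_subset_tsupport e),
    setIntegral_mul_eq_integral subset_rfl] at this

lemma tendsto_sqrt_sq_add_inv (s : ℝ) :
    Tendsto (fun k : ℕ => √(s ^ 2 + 1 / ((k : ℝ) + 1))) atTop (𝓝 |s|) := by
  have := (tendsto_one_div_add_atTop_nhds_zero_nat (𝕜 := ℝ)).const_add (s ^ 2)
  rw [add_zero] at this
  rw [← Real.sqrt_sq_eq_abs]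
  exact (Real.continuous_sqrt.tendsto _).comp this

/-- The positive part of a function with a weak derivative has a weak derivative. -/
lemma HasWeakDeriv.posPart {Ω : Set V} (hΩ : IsOpen Ω) {u g : V → ℝ} {e : V}
    (h : HasWeakDeriv Ω u e g) :
    HasWeakDeriv Ω (fun z => max (u z) 0) e (fun z => (1 + u z / |u z|) / 2 * g z) := by
  -- Regularize `max s 0 = (s + |s|) / 2` by replacing `|s|` with `√(s² + a k)`; the derivatives `θ
  -- k` stay bounded by one.
  let a : ℕ → ℝ := fun k => 1 / ((k : ℝ) + 1)
  have ha : ∀ k, 0 < a k := fun k => by positivity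
  have ha1 : ∀ k, a k ≤ 1 := fun k => by
    simp only [a]
    rw [div_le_one (by positivity)]
    linarith [Nat.cast_nonneg (α := ℝ) k]
  have hpos : ∀ k s, 0 < s ^ 2 + a k := fun k s => by have := ha k; positivity
  let F : ℕ → ℝ → ℝ := fun k s => (s + √(s ^ 2 + a k)) / 2
  let θ : ℕ → ℝ → ℝ := fun k s => (1 + s / √(s ^ 2 + a k)) / 2
  have habs : ∀ k s, |s| ≤ √(s ^ 2 + a k) := fun k s => by
    rw [← Real.sqrt_sq_eq_abs]
    exact Real.sqrt_le_sqrt (by linarith [ha k])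
  have hF : ∀ k s, HasDerivAt (F k) (θ k s) s := by
    intro k s
    have h1 : HasDerivAt (fun s => s ^ 2 + a k) (2 * s) s := by
      simpa using (hasDerivAt_pow 2 s).add_const (a k)
    have h2 := ((hasDerivAt_id s).add (h1.sqrt (hpos k s).ne')).div_const 2
    refine h2.congr_deriv ?_
    simp only [θ]
    have := (Real.sqrt_pos.2 (hpos k s)).ne'
    field_simp
  have hθc : ∀ k, Continuous (θ k) := by
    intro k
    refine (continuous_const.add (continuous_id.div (by fun_prop) fun s => ?_)).div_const 2
    exact (Real.sqrt_pos.2 (hpos k s)).ne'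
  have hquot : ∀ s r : ℝ, |s| ≤ r → |(1 + s / r) / 2| ≤ 1 := by
    intro s r hr
    have h1 : |s / r| ≤ 1 := by
      rw [abs_div]
      exact div_le_one_of_le₀ (hr.trans (le_abs_self r)) (abs_nonneg r)
    rw [abs_le] at h1 ⊢
    constructor <;> linarith [h1.1, h1.2]
  have hθ1 : ∀ k s, |θ k s| ≤ 1 := fun k s => hquot s _ (habs k s)
  have hFle : ∀ k s, |F k s| ≤ |s| + 1 := by
    intro k s
    have h1 : √(s ^ 2 + a k) ≤ |s| + 1 := by
      rw [Real.sqrt_le_left (by positivity)]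
      nlinarith [ha1 k, sq_abs s, abs_nonneg s]
    have h2 := abs_add_le s (√(s ^ 2 + a k))
    rw [abs_of_nonneg (Real.sqrt_nonneg (s ^ 2 + a k))] at h2
    simp only [F, abs_div, abs_two]
    linarith
  have hFlim : ∀ s, Tendsto (fun k => F k s) atTop (𝓝 (max s 0)) := by
    intro s
    have h1 := ((tendsto_sqrt_sq_add_inv s).const_add s).div_const 2
    have : (s + |s|) / 2 = max s 0 := by
      rcases le_total 0 s with hs | hs
      · rw [abs_of_nonneg hs, max_eq_left hs]; ring
      · rw [abs_of_nonpos hs, max_eq_right hs]; ring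
    rwa [this] at h1
  have hθlim : ∀ s, Tendsto (fun k => θ k s) atTop (𝓝 ((1 + s / |s|) / 2)) := by
    intro s
    -- At `s = 0` every `θ k` equals `1/2`, which agrees with the formula since `0 / 0 = 0`. It is
    -- not needed that `g` vanishes almost everywhere on `{u = 0}`.
    by_cases hs : s = 0
    · simp [θ, hs]
    · exact ((tendsto_const_nhds.div (tendsto_sqrt_sq_add_inv s)
        (abs_ne_zero.2 hs)).const_add 1).div_const 2
  have hu' : LocallyIntegrableOn (fun z => max (u z) 0) Ω volume :=
    LocallyIntegrableOn.comp_of_abs_le (F := fun s => max s 0) (c := 0) h.1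
      (by fun_prop) fun s => by
        rw [add_zero, abs_of_nonneg (le_max_right s 0)]
        exact max_le (le_abs_self s) (abs_nonneg s)
  have hg' : LocallyIntegrableOn (fun z => (1 + u z / |u z|) / 2 * g z) Ω volume :=
    LocallyIntegrableOn.bdd_mul_comp (θ := fun s => (1 + s / |s|) / 2) h.1 h.2
      (by fun_prop) fun s => hquot s _ le_rfl
  have hk := fun k => h.comp_hasDerivAt hΩ (hF k) (hθc k) (hθ1 k)
  refine .of_tendsto hk hu' hg' (fun ψ h1 h2 h3 => ?_) (fun ψ h1 h2 h3 => ?_)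
  · refine tendsto_integral_of_dominated_convergence (fun z => (|u z| + 1) * |ψ z|) (fun k => ?_)
      ?_ (fun k => Eventually.of_forall fun z => ?_) (Eventually.of_forall fun z => ?_)
    · exact (integrable_mul_of_tsupport_subset (hk k).1 h1 h2 h3).aestronglyMeasurable
    · have : LocallyIntegrableOn (fun z => |u z| + 1) Ω volume :=
        h.1.norm.add (locallyIntegrableOn_const 1)
      refine (integrable_mul_of_tsupport_subset this h1 h2 h3).norm.congr
        (Eventually.of_forall fun z => ?_)
      simp only [norm_mul, Real.norm_eq_abs]
      rw [abs_of_nonneg (by positivity : 0 ≤ |u z| + 1)]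
    · rw [norm_mul]
      exact mul_le_mul_of_nonneg_right (hFle k _) (abs_nonneg _)
    · exact (hFlim (u z)).mul_const _
  · refine tendsto_integral_of_dominated_convergence (fun z => |g z * ψ z|) (fun k => ?_)
      ?_ (fun k => Eventually.of_forall fun z => ?_) (Eventually.of_forall fun z => ?_)
    · exact (integrable_mul_of_tsupport_subset (hk k).2 h1 h2 h3).aestronglyMeasurable
    · exact (integrable_mul_of_tsupport_subset h.2 h1 h2 h3).norm
    · rw [mul_assoc, norm_mul]
      exact mul_le_of_le_one_left (norm_nonneg _) (hθ1 k _)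
    · exact ((hθlim (u z)).mul_const _).mul_const _

end ChainRule

/-! ### Weighted Poincaré inequality in time -/

section Poincare

open Filter Topology

variable {n : ℕ}

instance : (volume : Measure (SpaceTime n)).IsAddHaarMeasure := by
  rw [Measure.volume_eq_prod]
  infer_instance

lemma volume_restrict_prod (S : Set (EuclideanSpace ℝ (Fin n))) (I : Set ℝ) :
    (volume : Measure (SpaceTime n)).restrict (S ×ˢ I) =
      (volume.restrict S).prod (volume.restrict I) := by
  rw [Measure.prod_restrict, Measure.volume_eq_prod]

lemma isOpen_Q : IsOpen (Q n) := isOpen_univ.prod isOpen_Ioi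

lemma volume_restrict_Q : (volume : Measure (SpaceTime n)).restrict (Q n) =
    volume.prod (volume.restrict (Ioi 0)) := by
  rw [Q, volume_restrict_prod, Measure.restrict_univ]

lemma ae_spaceTime_of_ae_fst {p : EuclideanSpace ℝ (Fin n) → Prop} (h : ∀ᵐ x, p x) :
    ∀ᵐ z : SpaceTime n, p z.1 := by
  rw [Measure.volume_eq_prod]
  exact Measure.quasiMeasurePreserving_fst.ae h

lemma hasDerivAt_slice {w : SpaceTime n → ℝ} (hw : ContDiff ℝ ∞ w)
    (x : EuclideanSpace ℝ (Fin n)) (s : ℝ) :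
    HasDerivAt (fun s => w (x, s)) (fderiv ℝ w (x, s) (dirT n)) s := by
  have h1 : HasFDerivAt w (fderiv ℝ w (x, s)) (x, s) :=
    (hw.differentiable (by simp)).differentiableAt.hasFDerivAt
  have h2 : HasDerivAt (fun s : ℝ => (x, s)) (dirT n) s :=
    (hasDerivAt_const s x).prodMk (hasDerivAt_id s)
  exact h1.comp_hasDerivAt s h2

lemma continuous_fderiv_apply {w : SpaceTime n → ℝ} (hw : ContDiff ℝ ∞ w) (e : SpaceTime n) :
    Continuous fun z => fderiv ℝ w z e :=
  (hw.continuous_fderiv (by simp)).clm_apply continuous_const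

lemma enorm_le_add_lintegral_slice {w : SpaceTime n → ℝ} (hw : ContDiff ℝ ∞ w)
    (x : EuclideanSpace ℝ (Fin n)) {τ t : ℝ} (h : τ ≤ t) :
    ‖w (x, t)‖ₑ ≤ ‖w (x, τ)‖ₑ + ∫⁻ s in Ioc τ t, ‖fderiv ℝ w (x, s) (dirT n)‖ₑ := by
  have hc : Continuous fun s => fderiv ℝ w (x, s) (dirT n) :=
    (continuous_fderiv_apply hw _).comp (by fun_prop)
  have h1 := intervalIntegral.integral_eq_sub_of_hasDerivAt (a := τ) (b := t)
    (fun s _ => hasDerivAt_slice hw x s) (hc.intervalIntegrable _ _)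
  rw [intervalIntegral.integral_of_le h] at h1
  have h2 : w (x, t) = w (x, τ) + ∫ s in Ioc τ t, fderiv ℝ w (x, s) (dirT n) := by
    rw [h1]; ring
  rw [h2]
  exact (enorm_add_le _ _).trans (add_le_add le_rfl (enorm_integral_le_lintegral_enorm _))

/-- The fundamental theorem of calculus for the smooth `w` from a starting time `τ < 0`, averaged
over `τ ∈ (-1, 0)`. The second group of terms is the approximation error: it becomes small when `w`
approximates `W`, its time derivative approximates `g`, and `W` vanishes at negative times. -/
lemma enorm_le_lintegral_add_approx_error {W g w : SpaceTime n → ℝ} (hw : ContDiff ℝ ∞ w)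
    (hg0 : ∀ z : SpaceTime n, z.2 ≤ 0 → g z = 0) {x : EuclideanSpace ℝ (Fin n)} {t T : ℝ}
    (ht : 0 < t) (htT : t < T)
    (hgx : AEStronglyMeasurable (fun s => g (x, s)) volume) :
    ‖W (x, t)‖ₑ ≤ (∫⁻ s in Ioo 0 t, ‖g (x, s)‖ₑ) + (‖w (x, t) - W (x, t)‖ₑ +
      (∫⁻ s in Ioo (-1 : ℝ) 0, ‖w (x, s)‖ₑ) +
      ∫⁻ s in Ioo (-1) T, ‖fderiv ℝ w (x, s) (dirT n) - g (x, s)‖ₑ) := by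
  have step : ∀ τ ∈ Ioo (-1 : ℝ) 0, ‖w (x, t)‖ₑ ≤ ‖w (x, τ)‖ₑ +
      ((∫⁻ s in Ioo 0 t, ‖g (x, s)‖ₑ) +
        ∫⁻ s in Ioo (-1) T, ‖fderiv ℝ w (x, s) (dirT n) - g (x, s)‖ₑ) := by
    intro τ hτ
    refine (enorm_le_add_lintegral_slice hw x (hτ.2.le.trans ht.le)).trans
      (add_le_add le_rfl ?_)
    have e1 : ∀ s, ‖fderiv ℝ w (x, s) (dirT n)‖ₑ ≤
        ‖g (x, s)‖ₑ + ‖fderiv ℝ w (x, s) (dirT n) - g (x, s)‖ₑ := fun s => by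
      refine le_trans (le_of_eq ?_) (enorm_add_le _ _)
      congr 1; ring
    refine (lintegral_mono e1).trans ?_
    rw [lintegral_add_left' hgx.restrict.enorm]
    refine add_le_add ?_ (lintegral_mono_set fun s hs => ⟨hτ.1.trans hs.1, hs.2.trans_lt htT⟩)
    rw [← lintegral_indicator measurableSet_Ioo, ← lintegral_indicator measurableSet_Ioc]
    -- The endpoint `t` is the only positive time in `Ioc τ t` missing from `Ioo 0 t`.
    have hne : ∀ᵐ s : ℝ, s ≠ t := by simp [ae_iff]
    refine lintegral_mono_ae ?_
    filter_upwards [hne] with s hs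
    rcases le_or_gt s 0 with h0 | h0
    · simp [indicator, hg0 (x, s) h0]
    · by_cases hst : s ∈ Ioc τ t
      · have hst' : s ∈ Ioo 0 t := ⟨h0, lt_of_le_of_ne hst.2 hs⟩
        rw [indicator_of_mem hst, indicator_of_mem hst']
      · rw [indicator_of_notMem hst]
        exact zero_le
  have avg : ‖w (x, t)‖ₑ ≤ (∫⁻ s in Ioo (-1 : ℝ) 0, ‖w (x, s)‖ₑ) +
      ((∫⁻ s in Ioo 0 t, ‖g (x, s)‖ₑ) +
        ∫⁻ s in Ioo (-1) T, ‖fderiv ℝ w (x, s) (dirT n) - g (x, s)‖ₑ) := by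
    -- The interval of starting times has length one, so averaging costs no constant.
    calc ‖w (x, t)‖ₑ = ∫⁻ _ in Ioo (-1 : ℝ) 0, ‖w (x, t)‖ₑ := by simp
      _ ≤ ∫⁻ τ in Ioo (-1 : ℝ) 0, (‖w (x, τ)‖ₑ + ((∫⁻ s in Ioo 0 t, ‖g (x, s)‖ₑ) +
          ∫⁻ s in Ioo (-1) T, ‖fderiv ℝ w (x, s) (dirT n) - g (x, s)‖ₑ)) :=
        setLIntegral_mono' measurableSet_Ioo step
      _ = _ := by
        rw [lintegral_add_right _ measurable_const]
        simp
  calc ‖W (x, t)‖ₑ ≤ ‖w (x, t) - W (x, t)‖ₑ + ‖w (x, t)‖ₑ := by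
        rw [← enorm_neg (w (x, t) - W (x, t))]
        refine le_trans (le_of_eq ?_) (enorm_add_le _ _)
        congr 1; ring
    _ ≤ _ := (add_le_add le_rfl avg).trans (le_of_eq (by ring))

lemma lintegral_prod_fst {S : Set (EuclideanSpace ℝ (Fin n))} {I : Set ℝ}
    {a : EuclideanSpace ℝ (Fin n) → ℝ≥0∞} (ha : AEMeasurable a (volume.restrict S)) :
    ∫⁻ z : SpaceTime n in S ×ˢ I, a z.1 = (∫⁻ x in S, a x) * volume I := by
  rw [volume_restrict_prod, lintegral_prod _ ha.comp_fst]
  simp only [lintegral_const, Measure.restrict_apply_univ]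
  rw [lintegral_mul_const'' _ ha]

/-- A function vanishing for `t ≤ 0` is controlled by its weak time derivative. -/
lemma ae_enorm_le_lintegral_of_hasWeakDeriv {W g : SpaceTime n → ℝ}
    (h : HasWeakDeriv univ W (dirT n) g) (hW0 : ∀ z : SpaceTime n, z.2 ≤ 0 → W z = 0)
    (hg0 : ∀ z : SpaceTime n, z.2 ≤ 0 → g z = 0) :
    ∀ᵐ z ∂(volume.restrict (Q n)), ‖W z‖ₑ ≤ ∫⁻ s in Ioo 0 z.2, ‖g (z.1, s)‖ₑ := by
  have hgm : AEStronglyMeasurable g := by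
    simpa using h.2.aestronglyMeasurable
  have hWm : AEStronglyMeasurable W := by
    simpa using h.1.aestronglyMeasurable
  have hgx : ∀ᵐ x : EuclideanSpace ℝ (Fin n), AEStronglyMeasurable (fun s => g (x, s)) volume := by
    rw [Measure.volume_eq_prod] at hgm
    exact hgm.prodMk_left
  have main : ∀ N : ℕ, ∀ᵐ z : SpaceTime n, z ∈ Metric.closedBall 0 N ×ˢ Ioo (0 : ℝ) N →
      ‖W z‖ₑ ≤ ∫⁻ s in Ioo 0 z.2, ‖g (z.1, s)‖ₑ := by
    intro N
    set B : Set (EuclideanSpace ℝ (Fin n)) := Metric.closedBall 0 N with hB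
    set I : Set ℝ := Ioo 0 (N : ℝ) with hI
    have hBI : MeasurableSet (B ×ˢ I) :=
      Metric.isClosed_closedBall.measurableSet.prod measurableSet_Ioo
    set K : Set (SpaceTime n) := B ×ˢ Icc (-1 : ℝ) N with hK
    have hKc : IsCompact K := (isCompact_closedBall _ _).prod isCompact_Icc
    obtain ⟨w, hw, hw0, hw1⟩ := h.exists_smooth_approx isOpen_univ hKc (subset_univ _)
    let a : ℕ → EuclideanSpace ℝ (Fin n) → ℝ≥0∞ := fun k x =>
      ∫⁻ s in Ioo (-1 : ℝ) 0, ‖w k (x, s)‖ₑ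
    let b : ℕ → EuclideanSpace ℝ (Fin n) → ℝ≥0∞ := fun k x =>
      ∫⁻ s in Ioo (-1 : ℝ) N, ‖fderiv ℝ (w k) (x, s) (dirT n) - g (x, s)‖ₑ
    have hma : ∀ k, AEMeasurable (fun z => ‖w k z‖ₑ)
        ((volume.restrict B).prod (volume.restrict (Ioo (-1 : ℝ) 0))) := fun k =>
      (hw k).continuous.aestronglyMeasurable.enorm
    have hmb : ∀ k, AEMeasurable (fun z => ‖fderiv ℝ (w k) z (dirT n) - g z‖ₑ)
        ((volume.restrict B).prod (volume.restrict (Ioo (-1 : ℝ) N))) := fun k => by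
      rw [← volume_restrict_prod]
      exact ((continuous_fderiv_apply (hw k) _).aestronglyMeasurable.sub hgm.restrict).enorm
    have ham : ∀ k, AEMeasurable (a k) (volume.restrict B) := fun k =>
      (hma k).lintegral_prod_right'
    have hbm : ∀ k, AEMeasurable (b k) (volume.restrict B) := fun k =>
      (hmb k).lintegral_prod_right'
    let E : ℕ → SpaceTime n → ℝ≥0∞ := fun k z => ‖w k z - W z‖ₑ + a k z.1 + b k z.1
    have ham' : ∀ k, AEMeasurable (fun z : SpaceTime n => a k z.1)
        (volume.restrict (B ×ˢ I)) := fun k => by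
      rw [volume_restrict_prod]; exact (ham k).comp_fst
    have hbm' : ∀ k, AEMeasurable (fun z : SpaceTime n => b k z.1)
        (volume.restrict (B ×ˢ I)) := fun k => by
      rw [volume_restrict_prod]; exact (hbm k).comp_fst
    have hcm : ∀ k, AEMeasurable (fun z : SpaceTime n => ‖w k z - W z‖ₑ)
        (volume.restrict (B ×ˢ I)) := fun k =>
      ((hw k).continuous.aestronglyMeasurable.sub hWm.restrict).enorm
    have hEm : ∀ k, AEMeasurable (E k) (volume.restrict (B ×ˢ I)) := fun k =>
      ((hcm k).add (ham' k)).add (hbm' k)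
    -- The errors `a k` and `b k` do not depend on `t`, so integrating them over `I` gives the
    -- factor `N`. In `a k` the function `w k` equals `w k - W`, because `W` vanishes at negative
    -- times.
    have hle : ∀ k, ∫⁻ z in B ×ˢ I, E k z ≤
        (∫⁻ z in K, ‖w k z - W z‖ₑ) + (∫⁻ z in K, ‖w k z - W z‖ₑ) * N +
          (∫⁻ z in K, ‖fderiv ℝ (w k) z (dirT n) - g z‖ₑ) * N := by
      intro k
      have hvol : volume I = N := by simp [hI]
      rw [lintegral_add_right' _ (hbm' k), lintegral_add_right' _ (ham' k),
        lintegral_prod_fst (ham k), lintegral_prod_fst (hbm k), hvol]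
      refine add_le_add (add_le_add ?_ ?_) ?_
      · exact lintegral_mono_set (prod_mono subset_rfl fun s hs => ⟨by linarith [hs.1], hs.2.le⟩)
      · gcongr
        rw [← lintegral_prod _ (hma k), ← volume_restrict_prod]
        have hs : B ×ˢ Ioo (-1 : ℝ) 0 ⊆ K :=
          prod_mono subset_rfl fun s hs => ⟨hs.1.le, hs.2.le.trans (Nat.cast_nonneg N)⟩
        refine le_trans (le_of_eq ?_) (lintegral_mono_set hs)
        refine setLIntegral_congr_fun
          (Metric.isClosed_closedBall.measurableSet.prod measurableSet_Ioo) fun z hz => ?_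
        simp only [hW0 z hz.2.2.le, sub_zero]
      · gcongr
        rw [← lintegral_prod _ (hmb k), ← volume_restrict_prod]
        exact lintegral_mono_set (prod_mono subset_rfl Ioo_subset_Icc_self)
    have hlim : Tendsto (fun k => ∫⁻ z in B ×ˢ I, E k z) atTop (𝓝 0) := by
      have h1 := (hw0.add (ENNReal.Tendsto.mul_const (b := (N : ℝ≥0∞)) hw0
        (Or.inr (by simp)))).add
        (ENNReal.Tendsto.mul_const (b := (N : ℝ≥0∞)) hw1 (Or.inr (by simp)))
      simp only [zero_mul, add_zero] at h1
      exact tendsto_of_tendsto_of_tendsto_of_le_of_le tendsto_const_nhds h1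
        (fun _ => zero_le) hle
    -- By Fatou the lower limit of the errors is zero almost everywhere, so no subsequence is
    -- needed.
    have hzero : ∫⁻ z in B ×ˢ I, liminf (fun k => E k z) atTop = 0 := by
      refine le_antisymm ((lintegral_liminf_le' hEm).trans ?_) zero_le
      rw [hlim.liminf_eq]
    have hliminf : AEMeasurable (fun z => liminf (fun k => E k z) atTop)
        (volume.restrict (B ×ˢ I)) := by
      have hmk : (fun z => liminf (fun k => (hEm k).mk _ z) atTop) =ᵐ[volume.restrict (B ×ˢ I)]
          fun z => liminf (fun k => E k z) atTop := by
        filter_upwards [ae_all_iff.2 fun k => (hEm k).ae_eq_mk] with z hz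
        simp only [hz]
      exact ⟨_, Measurable.liminf fun k => (hEm k).measurable_mk, hmk.symm⟩
    rw [lintegral_eq_zero_iff' hliminf, Filter.EventuallyEq,
      ae_restrict_iff' hBI] at hzero
    filter_upwards [hzero, ae_spaceTime_of_ae_fst hgx] with z hz hgz hzBI
    have hb : ∀ k, ‖W z‖ₑ - (∫⁻ s in Ioo 0 z.2, ‖g (z.1, s)‖ₑ) ≤ E k z := fun k =>
      tsub_le_iff_left.2 (enorm_le_lintegral_add_approx_error (hw k) hg0 hzBI.2.1 hzBI.2.2 hgz)
    have h0 := hz hzBI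
    have h1 : ‖W z‖ₑ - (∫⁻ s in Ioo 0 z.2, ‖g (z.1, s)‖ₑ) ≤ liminf (fun k => E k z) atTop :=
      le_liminf_of_le (by isBoundedDefault) (Eventually.of_forall hb)
    rw [h0] at h1
    exact tsub_eq_zero_iff_le.1 (le_antisymm h1 zero_le)
  rw [ae_restrict_iff' isOpen_Q.measurableSet]
  filter_upwards [ae_all_iff.2 main] with z hz hzQ
  obtain ⟨N, hN⟩ := exists_nat_gt (max ‖z.1‖ z.2)
  exact hz N ⟨by simpa using (le_max_left _ _).trans hN.le, hzQ.2, (le_max_right _ _).trans_lt hN⟩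

lemma sq_lintegral_le {f : ℝ → ℝ≥0∞} {t : ℝ}
    (hf : AEMeasurable f (volume.restrict (Ioo 0 t))) :
    (∫⁻ s in Ioo 0 t, f s) ^ 2 ≤ ENNReal.ofReal t * ∫⁻ s in Ioo 0 t, f s ^ 2 := by
  have := ENNReal.lintegral_mul_le_Lp_mul_Lq (volume.restrict (Ioo 0 t))
    Real.HolderConjugate.two_two hf (aemeasurable_const (b := (1 : ℝ≥0∞)))
  simp only [Pi.mul_apply, mul_one, ENNReal.one_rpow, lintegral_const, one_mul,
    Measure.restrict_apply_univ, Real.volume_Ioo, sub_zero] at this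
  calc _ ≤ _ := pow_le_pow_left' this 2
    _ = _ := by
      rw [mul_pow, ← ENNReal.rpow_natCast, ← ENNReal.rpow_natCast, ← ENNReal.rpow_mul,
        ← ENNReal.rpow_mul]
      norm_num [mul_comm]

/-- Weighted Poincaré inequality in time. -/
lemma lintegral_exp_sq_le {W g : SpaceTime n → ℝ}
    (h : HasWeakDeriv univ W (dirT n) g) (hW0 : ∀ z : SpaceTime n, z.2 ≤ 0 → W z = 0)
    (hg0 : ∀ z : SpaceTime n, z.2 ≤ 0 → g z = 0) :
    ∫⁻ z in Q n, ‖Real.exp (-z.2) * W z‖ₑ ^ 2 ≤ ∫⁻ z in Q n, ‖Real.exp (-z.2 / 2) * g z‖ₑ ^ 2 := by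
  have hgm : AEStronglyMeasurable g := by
    simpa using h.2.aestronglyMeasurable
  have hgx : ∀ᵐ x : EuclideanSpace ℝ (Fin n), AEStronglyMeasurable (fun s => g (x, s)) volume := by
    rw [Measure.volume_eq_prod] at hgm
    exact hgm.prodMk_left
  let I : EuclideanSpace ℝ (Fin n) → ℝ≥0∞ := fun x =>
    ∫⁻ s in Ioi (0 : ℝ), ‖Real.exp (-s / 2) * g (x, s)‖ₑ ^ 2
  have hm : AEMeasurable (fun z : SpaceTime n => ‖Real.exp (-z.2 / 2) * g z‖ₑ ^ 2)
      (volume.prod (volume.restrict (Ioi (0 : ℝ)))) := by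
    rw [← volume_restrict_Q]
    refine AEMeasurable.pow_const ?_ 2
    exact ((by fun_prop : Continuous fun z : SpaceTime n =>
      Real.exp (-z.2 / 2)).aestronglyMeasurable.mul hgm.restrict).enorm
  have hIm : AEMeasurable I := hm.lintegral_prod_right'
  -- Cauchy–Schwarz on `(0, t)` costs a factor `t`, and inserting the weight `e^{-s} ≥ e^{-t}` costs
  -- `e^t`; against `e^{-2t}` this leaves `t e^{-t}`.
  have pt : ∀ᵐ z ∂(volume.restrict (Q n)), ‖Real.exp (-z.2) * W z‖ₑ ^ 2 ≤
      ENNReal.ofReal (z.2 * Real.exp (-z.2)) * I z.1 := by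
    have h2 := ae_restrict_of_ae (s := Q n) (ae_spaceTime_of_ae_fst hgx)
    filter_upwards [ae_enorm_le_lintegral_of_hasWeakDeriv h hW0 hg0, h2,
      ae_restrict_mem isOpen_Q.measurableSet] with z hz hgz hzQ
    have ht : 0 < z.2 := hzQ.2
    have e1 : ∫⁻ s in Ioo 0 z.2, ‖g (z.1, s)‖ₑ ^ 2 ≤ ENNReal.ofReal (Real.exp z.2) * I z.1 := by
      rw [← lintegral_const_mul' _ _ (by simp)]
      refine le_trans (setLIntegral_mono' (g := fun s => ENNReal.ofReal (Real.exp z.2) *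
        ‖Real.exp (-s / 2) * g (z.1, s)‖ₑ ^ 2) measurableSet_Ioo fun s hs => ?_)
        (lintegral_mono_set Ioo_subset_Ioi_self)
      rw [enorm_mul, mul_pow, ← mul_assoc]
      refine le_mul_of_one_le_left zero_le ?_
      rw [Real.enorm_of_nonneg (Real.exp_pos _).le, ← ENNReal.ofReal_pow (Real.exp_pos _).le,
        ← ENNReal.ofReal_mul (Real.exp_pos _).le, ← Real.exp_nat_mul, ← Real.exp_add,
        ENNReal.one_le_ofReal, Real.one_le_exp_iff]
      push_cast
      linarith [hs.2]
    calc ‖Real.exp (-z.2) * W z‖ₑ ^ 2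
        = ENNReal.ofReal (Real.exp (-z.2)) ^ 2 * ‖W z‖ₑ ^ 2 := by
          rw [enorm_mul, mul_pow, Real.enorm_of_nonneg (Real.exp_pos _).le]
      _ ≤ ENNReal.ofReal (Real.exp (-z.2)) ^ 2 *
          (ENNReal.ofReal z.2 * (ENNReal.ofReal (Real.exp z.2) * I z.1)) := by
          gcongr
          exact (pow_le_pow_left' hz 2).trans ((sq_lintegral_le hgz.restrict.enorm).trans
            (by gcongr))
      _ = _ := by
          rw [← mul_assoc, ← mul_assoc, ← ENNReal.ofReal_pow (Real.exp_pos _).le,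
            ← ENNReal.ofReal_mul (by positivity), ← ENNReal.ofReal_mul (by positivity)]
          congr 2
          have : Real.exp (-z.2) * Real.exp z.2 = 1 := by rw [← Real.exp_add]; simp
          linear_combination (z.2 * Real.exp (-z.2)) * this
  -- This is `Γ(2) = 1`, the constant of the inequality.
  have hint : ∫⁻ s in Ioi (0 : ℝ), ENNReal.ofReal (s * Real.exp (-s)) = 1 := by
    have h1 : IntegrableOn (fun s : ℝ => Real.exp (-s) * s ^ ((2 : ℝ) - 1)) (Ioi 0) :=
      Real.GammaIntegral_convergent (by norm_num)
    have h2 := Real.Gamma_eq_integral (s := 2) (by norm_num)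
    rw [Real.Gamma_two] at h2
    have e : ∀ s : ℝ, s * Real.exp (-s) = Real.exp (-s) * s ^ ((2 : ℝ) - 1) := by
      intro s; norm_num [mul_comm]
    simp only [e]
    rw [← ofReal_integral_eq_lintegral_ofReal h1, ← h2, ENNReal.ofReal_one]
    filter_upwards [ae_restrict_mem measurableSet_Ioi] with s hs
    have : 0 < s := hs
    positivity
  calc _ ≤ ∫⁻ z in Q n, ENNReal.ofReal (z.2 * Real.exp (-z.2)) * I z.1 := lintegral_mono_ae pt
    _ = ∫⁻ x, I x := by
      rw [volume_restrict_Q, lintegral_prod]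
      · refine lintegral_congr fun x => ?_
        dsimp only
        rw [lintegral_mul_const _ (by fun_prop), hint, one_mul]
      · exact AEMeasurable.mul (by fun_prop) hIm.comp_fst
    _ = _ := by rw [volume_restrict_Q, lintegral_prod _ hm]

end Poincare

/-! ### Explicit weak derivatives, the trace, and the energy as one integral -/

section Representation

open Filter Topology

variable {n : ℕ}

lemma isOpen_Qplus (r : ℝ) : IsOpen (Qplus n r) := Metric.isOpen_ball.prod isOpen_Ioo

lemma Qplus_subset_Q (r : ℝ) : Qplus n r ⊆ Q n := prod_mono (subset_univ _) fun _ h => h.1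

lemma exists_Qplus_of_isBounded {K : Set (SpaceTime n)} (hK : Bornology.IsBounded K) :
    ∃ r₀ : ℝ, 0 < r₀ ∧ ∀ r, r₀ ≤ r → K ∩ Q n ⊆ Qplus n r := by
  obtain ⟨R, hR⟩ := hK.subset_closedBall 0
  -- Taking `r ≥ 1` gives `r ≤ r²`, so a bound by `r` on the time coordinate suffices for the
  -- parabolic cylinder.
  refine ⟨max R 0 + 1, by positivity, fun r hr z hz => ?_⟩
  have h1 : ‖z‖ ≤ R := by simpa using hR hz.1
  have h2 : ‖z.1‖ ≤ R := (norm_fst_le z).trans h1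
  have h3 : z.2 ≤ R := (le_abs_self _).trans ((norm_snd_le z).trans h1)
  have h4 : R < r := by linarith [le_max_left R 0]
  have h5 : 1 ≤ r := by linarith [le_max_right R 0]
  refine ⟨by simpa using h2.trans_lt h4, hz.2.2, ?_⟩
  nlinarith

lemma isBounded_Qplus (r : ℝ) : Bornology.IsBounded (Qplus n r) :=
  Metric.isBounded_ball.prod (Metric.isBounded_Ioo _ _)

lemma volume_Qplus_lt_top (r : ℝ) : volume (Qplus n r) < ⊤ := (isBounded_Qplus r).measure_lt_top

instance (r : ℝ) : IsFiniteMeasure ((volume : Measure (SpaceTime n)).restrict (Qplus n r)) :=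
  ⟨by simpa using volume_Qplus_lt_top r⟩

/-- The cylinders reach down to `t = 0`, so square integrability on them controls `f` up to that
boundary and the extension by zero is integrable across it. -/
lemma locallyIntegrable_indicator_Q {f : SpaceTime n → ℝ}
    (hf : ∀ r : ℝ, 0 < r → MemLp f 2 (volume.restrict (Qplus n r))) :
    LocallyIntegrable ((Q n).indicator f) := by
  intro x
  obtain ⟨r, hr, h⟩ := exists_Qplus_of_isBounded (Metric.isBounded_ball (x := x) (r := 1))
  refine ⟨Metric.ball x 1, Metric.ball_mem_nhds x one_pos, ?_⟩
  rw [integrableOn_indicator_iff isOpen_Q.measurableSet, inter_comm]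
  exact IntegrableOn.mono_set ((hf r hr).integrable (by simp)) (h r le_rfl)

lemma locallyIntegrableOn_Q {f : SpaceTime n → ℝ}
    (hf : ∀ r : ℝ, 0 < r → MemLp f 2 (volume.restrict (Qplus n r))) :
    LocallyIntegrableOn f (Q n) volume :=
  ((locallyIntegrable_indicator_Q hf).locallyIntegrableOn (Q n)).congr
    (indicator_ae_eq_restrict isOpen_Q.measurableSet)

lemma locallyIntegrable_comp_fst {u₀ : EuclideanSpace ℝ (Fin n) → ℝ}
    (h : LocallyIntegrable u₀) : LocallyIntegrable fun z : SpaceTime n => u₀ z.1 := by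
  intro z
  refine ⟨Metric.closedBall z.1 1 ×ˢ Metric.closedBall z.2 1,
    prod_mem_nhds (Metric.closedBall_mem_nhds _ one_pos) (Metric.closedBall_mem_nhds _ one_pos), ?_⟩
  rw [IntegrableOn, volume_restrict_prod]
  have : IsFiniteMeasure ((volume : Measure ℝ).restrict (Metric.closedBall z.2 1)) :=
    ⟨by simp [Real.volume_closedBall]⟩
  exact (h.integrableOn_isCompact (isCompact_closedBall z.1 1)).integrable.comp_fst _

/-- `w` for positive times, extended by the initial datum `u₀` to nonpositive times. -/
noncomputable def initialExt (w : SpaceTime n → ℝ) (u₀ : EuclideanSpace ℝ (Fin n) → ℝ) :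
    SpaceTime n → ℝ :=
  fun z => (Q n).indicator w z + (Q n)ᶜ.indicator (fun z => u₀ z.1) z

lemma initialExt_of_mem {w : SpaceTime n → ℝ} {u₀ : EuclideanSpace ℝ (Fin n) → ℝ}
    {z : SpaceTime n} (hz : z ∈ Q n) : initialExt w u₀ z = w z := by
  simp [initialExt, hz]

lemma initialExt_of_notMem {w : SpaceTime n → ℝ} {u₀ : EuclideanSpace ℝ (Fin n) → ℝ}
    {z : SpaceTime n} (hz : z ∉ Q n) : initialExt w u₀ z = u₀ z.1 := by
  simp [initialExt, hz]

lemma compl_Q : (Q n)ᶜ = univ ×ˢ Iic 0 := by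
  ext z; simp [Q]

lemma HasCompactSupport.slice {φ : SpaceTime n → ℝ} (hc : HasCompactSupport φ)
    (x : EuclideanSpace ℝ (Fin n)) : HasCompactSupport fun s => φ (x, s) := by
  refine HasCompactSupport.of_support_subset_isCompact (hc.isCompact.image continuous_snd) ?_
  exact fun s hs => ⟨(x, s), subset_tsupport _ hs, rfl⟩

/-- On each time line `∂ₜφ` integrates over `(-∞, 0]` to `φ (x, 0)`. This is where the boundary term
of Green's formula comes from. -/
lemma setIntegral_compl_Q {u₀ : EuclideanSpace ℝ (Fin n) → ℝ} (h : LocallyIntegrable u₀)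
    {φ : SpaceTime n → ℝ} (hφ : ContDiff ℝ ∞ φ) (hc : HasCompactSupport φ) :
    ∫ z in (Q n)ᶜ, u₀ z.1 * fderiv ℝ φ z (dirT n) = ∫ x, u₀ x * φ (x, 0) := by
  have hT : IsTestFunction univ φ := ⟨hφ, hc, subset_univ _⟩
  have hint : Integrable fun z : SpaceTime n => u₀ z.1 * fderiv ℝ φ z (dirT n) :=
    integrable_mul_of_tsupport_subset
      ((locallyIntegrable_comp_fst h).locallyIntegrableOn univ) (hT.continuous_fderiv _)
      (hT.hasCompactSupport_fderiv _) (subset_univ _)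
  have hr : (volume : Measure (SpaceTime n)).restrict (Q n)ᶜ =
      volume.prod (volume.restrict (Iic 0)) := by
    rw [compl_Q, volume_restrict_prod, Measure.restrict_univ]
  rw [hr, integral_prod _ (by rw [← hr]; exact hint.restrict)]
  refine integral_congr_ae (Eventually.of_forall fun x => ?_)
  dsimp only
  rw [integral_const_mul]
  congr 1
  have hcs := HasCompactSupport.slice hc x
  have hd : deriv (fun s => φ (x, s)) = fun s => fderiv ℝ φ (x, s) (dirT n) :=
    funext fun s => (hasDerivAt_slice hφ x s).deriv
  have := HasCompactSupport.integral_Iic_deriv_eq (f := fun s => φ (x, s))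
    (hφ.comp (contDiff_const.prodMk contDiff_id) |>.of_le (by simp)) hcs 0
  rwa [hd] at this

/-- The trace condition, as the existence of a weak time derivative of the extension by the
initial datum. -/
lemma hasWeakDeriv_initialExt_iff {w g : SpaceTime n → ℝ} {u₀ : EuclideanSpace ℝ (Fin n) → ℝ}
    (hw : LocallyIntegrable ((Q n).indicator w)) (hg : LocallyIntegrable ((Q n).indicator g))
    (hu₀ : LocallyIntegrable u₀) :
    HasWeakDeriv univ (initialExt w u₀) (dirT n) ((Q n).indicator g) ↔
      ∀ φ : SpaceTime n → ℝ, ContDiff ℝ ∞ φ → HasCompactSupport φ →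
        ∫ z in Q n, (w z * fderiv ℝ φ z (dirT n) + g z * φ z) = - ∫ x, u₀ x * φ (x, 0) := by
  have hQ : MeasurableSet (Q n) := isOpen_Q.measurableSet
  have hext : LocallyIntegrable (initialExt w u₀) :=
    hw.add ((locallyIntegrable_comp_fst hu₀).indicator hQ.compl)
  have hext' := hext.locallyIntegrableOn univ
  have hg' := hg.locallyIntegrableOn univ
  have key : ∀ φ : SpaceTime n → ℝ, ContDiff ℝ ∞ φ → HasCompactSupport φ →
      (∫ z, initialExt w u₀ z * fderiv ℝ φ z (dirT n) = - ∫ z, (Q n).indicator g z * φ z ↔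
      ∫ z in Q n, (w z * fderiv ℝ φ z (dirT n) + g z * φ z) = - ∫ x, u₀ x * φ (x, 0)) := by
    intro φ h1 h2
    have hT : IsTestFunction univ φ := ⟨h1, h2, subset_univ _⟩
    have i1 := integrable_mul_of_tsupport_subset hext' (hT.continuous_fderiv (dirT n))
      (hT.hasCompactSupport_fderiv _) (subset_univ _)
    have i2 := integrable_mul_of_tsupport_subset hg' h1.continuous h2 (subset_univ _)
    have c1 : EqOn (fun z => initialExt w u₀ z * fderiv ℝ φ z (dirT n))
        (fun z => w z * fderiv ℝ φ z (dirT n)) (Q n) := fun z hz => by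
      simp only [initialExt_of_mem hz]
    have c2 : EqOn (fun z => initialExt w u₀ z * fderiv ℝ φ z (dirT n))
        (fun z => u₀ z.1 * fderiv ℝ φ z (dirT n)) (Q n)ᶜ := fun z hz => by
      simp only [initialExt_of_notMem hz]
    have c3 : EqOn (fun z => (Q n).indicator g z * φ z) (fun z => g z * φ z) (Q n) := fun z hz => by
      simp only [indicator_of_mem hz]
    have e1 := integral_add_compl hQ i1
    rw [setIntegral_congr_fun hQ.compl c2, setIntegral_compl_Q hu₀ h1 h2,
      setIntegral_congr_fun hQ c1] at e1
    have e2 : ∫ z, (Q n).indicator g z * φ z = ∫ z in Q n, g z * φ z := by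
      rw [← setIntegral_congr_fun hQ c3, setIntegral_eq_integral_of_forall_compl_eq_zero]
      intro z hz
      rw [indicator_of_notMem hz, zero_mul]
    rw [integral_add (i1.integrableOn.congr_fun c1 hQ) (i2.integrableOn.congr_fun c3 hQ), ← e1, e2]
    constructor <;> intro h <;> linarith
  constructor
  · exact fun h φ h1 h2 => (key φ h1 h2).1 (h.integral_mul_fderiv ⟨h1, h2, subset_univ _⟩)
  · exact fun h => .of_integral hext' hg' fun φ hφ =>
      (key φ hφ.1 hφ.2).2 (h φ hφ.1 hφ.2)

/-- The coordinate directions of space-time; `none` is the time direction. -/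
noncomputable def dir (i : Option (Fin n)) : SpaceTime n := i.elim (dirT n) dirX

/-- `w ∈ 𝒰₀` with weak derivatives `G` in the coordinate directions. -/
structure Rep (u₀ : EuclideanSpace ℝ (Fin n) → ℝ) (w : SpaceTime n → ℝ)
    (G : Option (Fin n) → SpaceTime n → ℝ) : Prop where
  memLp : ∀ r : ℝ, 0 < r → MemLp w 2 (volume.restrict (Qplus n r))
  memLp_deriv : ∀ i, ∀ r : ℝ, 0 < r → MemLp (G i) 2 (volume.restrict (Qplus n r))
  hasWeakDeriv : ∀ i, HasWeakDeriv (Q n) w (dir i) (G i)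
  trace : HasWeakDeriv univ (initialExt w u₀) (dirT n) ((Q n).indicator (G none))

/-- Weak derivatives on the cylinders `Qplus n N` glue to a weak derivative on `Q n`. -/
lemma exists_hasWeakDeriv_Q {w : SpaceTime n → ℝ} {e : SpaceTime n} (g : ℕ → SpaceTime n → ℝ)
    (hw : ∀ r : ℝ, 0 < r → MemLp w 2 (volume.restrict (Qplus n r)))
    (hg2 : ∀ N : ℕ, MemLp (g N) 2 (volume.restrict (Qplus n (N + 1))))
    (hg : ∀ N : ℕ, HasWeakDeriv (Qplus n (N + 1)) w e (g N)) :
    ∃ G, (∀ r : ℝ, 0 < r → MemLp G 2 (volume.restrict (Qplus n r))) ∧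
      HasWeakDeriv (Q n) w e G := by
  have hex : ∀ z : SpaceTime n, ∃ N : ℕ, z ∈ Q n → z ∈ Qplus n (N + 1) := by
    intro z
    obtain ⟨r, -, h⟩ := exists_Qplus_of_isBounded (Bornology.isBounded_singleton (x := z))
    obtain ⟨N, hN⟩ := exists_nat_gt r
    exact ⟨N, fun hz => h (N + 1) (by linarith) ⟨rfl, hz⟩⟩
  choose ν hν using hex
  let G : SpaceTime n → ℝ := fun z => g (ν z) z
  -- Weak derivatives are unique on the overlap of two cylinders, so outside one null set the
  -- cylinder chosen for `z` does not matter.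
  have hcompat : ∀ᵐ z : SpaceTime n, ∀ a b : ℕ, z ∈ Qplus n (a + 1) → z ∈ Qplus n (b + 1) →
      g a z = g b z := by
    rw [ae_all_iff]; intro a
    rw [ae_all_iff]; intro b
    have := ((hg a).mono inter_subset_left).ae_eq ((isOpen_Qplus _).inter (isOpen_Qplus _))
      ((hg b).mono (inter_subset_right (s := Qplus n (a + 1))))
    rw [Filter.EventuallyEq, ae_restrict_iff'
      ((isOpen_Qplus _).inter (isOpen_Qplus _)).measurableSet] at this
    filter_upwards [this] with z hz h1 h2 using hz ⟨h1, h2⟩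
  have hGN : ∀ N : ℕ, g N =ᵐ[volume.restrict (Qplus n (N + 1))] G := by
    intro N
    rw [Filter.EventuallyEq, ae_restrict_iff' (isOpen_Qplus _).measurableSet]
    filter_upwards [hcompat] with z hz hzN
    exact hz _ _ hzN (hν z (Qplus_subset_Q _ hzN))
  have hr : ∀ K : Set (SpaceTime n), Bornology.IsBounded K → ∃ N : ℕ, K ∩ Q n ⊆ Qplus n (N + 1) := by
    intro K hK
    obtain ⟨r, -, h⟩ := exists_Qplus_of_isBounded hK
    obtain ⟨N, hN⟩ := exists_nat_gt r
    exact ⟨N, h _ (by linarith)⟩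
  have hG2 : ∀ r : ℝ, 0 < r → MemLp G 2 (volume.restrict (Qplus n r)) := by
    intro r _
    obtain ⟨N, hN⟩ := hr _ (isBounded_Qplus r)
    rw [inter_eq_left.2 (Qplus_subset_Q r)] at hN
    exact ((memLp_congr_ae (hGN N)).1 (hg2 N)).mono_measure (Measure.restrict_mono hN le_rfl)
  refine ⟨G, hG2, .of_integral (locallyIntegrableOn_Q hw) (locallyIntegrableOn_Q hG2)
    fun φ hφ => ?_⟩
  obtain ⟨N, hN⟩ := hr _ hφ.compact.isCompact.isBounded
  rw [inter_eq_left.2 hφ.support_subset] at hN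
  exact ((hg N).congr_ae (ae_eq_refl _) (hGN N)).integral_mul_fderiv ⟨hφ.1, hφ.2, hN⟩

lemma eq_sum_dir (e : SpaceTime n) :
    e = ∑ i : Option (Fin n), (i.elim e.2 fun i => e.1 i) • dir i := by
  rw [Fintype.sum_option]
  refine Prod.ext ?_ ?_
  · simp only [dir, Option.elim_none, Option.elim_some, dirT, dirX, Prod.fst_add, Prod.smul_fst,
      smul_zero, zero_add, Prod.fst_sum]
    ext j
    simp [Finset.sum_apply, Pi.single_apply]
  · simp [dir, dirT, dirX, Prod.snd_sum]

/-- `MemH1` asks for a derivative in every direction; those outside the coordinate axes come by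
linearity. -/
lemma Rep.mem_U0 {u₀ : EuclideanSpace ℝ (Fin n) → ℝ} (hu₀ : LocallyIntegrable u₀)
    {w : SpaceTime n → ℝ} {G : Option (Fin n) → SpaceTime n → ℝ} (h : Rep u₀ w G) : w ∈ U0 u₀ := by
  refine ⟨fun r hr => ⟨h.memLp r hr, fun e => ?_⟩, ?_⟩
  · refine ⟨fun z => ∑ i, (i.elim e.2 fun i => e.1 i) * G i z,
      memLp_finsetSum _ fun i _ => (h.memLp_deriv i r hr).const_mul _, ?_⟩
    have h1 := HasWeakDeriv.sum_dir (locallyIntegrableOn_Q h.memLp) Finset.univ fun i _ =>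
      (h.hasWeakDeriv i).smul_dir (i.elim e.2 fun i => e.1 i)
    rw [← eq_sum_dir e] at h1
    exact h1.mono (Qplus_subset_Q r)
  · intro φ h1 h2
    have e1 : weakDt w =ᵐ[volume.restrict (Q n)] G none :=
      (h.hasWeakDeriv none).weakDeriv_ae_eq isOpen_Q
    rw [← (hasWeakDeriv_initialExt_iff (locallyIntegrable_indicator_Q h.memLp)
      (locallyIntegrable_indicator_Q (h.memLp_deriv none)) hu₀).1 h.trace φ h1 h2]
    refine integral_congr_ae (e1.mono fun z hz => ?_)
    simp only [hz]

/-- Membership in `U n` gives derivatives on each cylinder separately; they are glued to derivatives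
on `Q n`. -/
lemma exists_rep_of_mem_U0 {u₀ : EuclideanSpace ℝ (Fin n) → ℝ} (hu₀ : LocallyIntegrable u₀)
    {w : SpaceTime n → ℝ} (h : w ∈ U0 u₀) : ∃ G, Rep u₀ w G := by
  have hw : ∀ r : ℝ, 0 < r → MemLp w 2 (volume.restrict (Qplus n r)) := fun r hr =>
    (h.1 r hr).memLp
  have hG : ∀ i : Option (Fin n), ∃ G, (∀ r : ℝ, 0 < r → MemLp G 2 (volume.restrict (Qplus n r))) ∧
      HasWeakDeriv (Q n) w (dir i) G := by
    intro i
    choose g hg1 hg2 using fun N : ℕ => (h.1 (N + 1) (by positivity)).exists_weakDeriv (dir i)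
    exact exists_hasWeakDeriv_Q g hw hg1 hg2
  choose G hG1 hG2 using hG
  refine ⟨G, hw, hG1, hG2, ?_⟩
  rw [hasWeakDeriv_initialExt_iff (locallyIntegrable_indicator_Q hw)
    (locallyIntegrable_indicator_Q (hG1 none)) hu₀]
  intro φ h1 h2
  have e1 : weakDt w =ᵐ[volume.restrict (Q n)] G none :=
    (hG2 none).weakDeriv_ae_eq isOpen_Q
  rw [← h.2 φ h1 h2]
  refine integral_congr_ae (e1.mono fun z hz => ?_)
  simp only [hz]

/-- The integrand of the functional, with the weak derivatives given by `G`. -/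
noncomputable def energyDensity (γ ε : ℝ) (w : SpaceTime n → ℝ)
    (G : Option (Fin n) → SpaceTime n → ℝ) (z : SpaceTime n) : ℝ :=
  Real.exp (-z.2) * ((G none z) ^ 2 + ε * ∑ i : Fin n, (G (some i) z) ^ 2 +
    2 * ε * (max (w z) 0) ^ γ)

lemma Rep.aestronglyMeasurable {u₀ : EuclideanSpace ℝ (Fin n) → ℝ} {w : SpaceTime n → ℝ}
    {G : Option (Fin n) → SpaceTime n → ℝ} (h : Rep u₀ w G) :
    AEStronglyMeasurable w (volume.restrict (Q n)) :=
  (h.hasWeakDeriv none).1.aestronglyMeasurable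

lemma Rep.aestronglyMeasurable_deriv {u₀ : EuclideanSpace ℝ (Fin n) → ℝ} {w : SpaceTime n → ℝ}
    {G : Option (Fin n) → SpaceTime n → ℝ} (h : Rep u₀ w G) (i : Option (Fin n)) :
    AEStronglyMeasurable (G i) (volume.restrict (Q n)) :=
  (h.hasWeakDeriv i).2.aestronglyMeasurable

lemma Rep.aemeasurable_energyDensity {u₀ : EuclideanSpace ℝ (Fin n) → ℝ} {w : SpaceTime n → ℝ}
    {G : Option (Fin n) → SpaceTime n → ℝ} (h : Rep u₀ w G) (γ ε : ℝ) :
    AEMeasurable (energyDensity γ ε w G) (volume.restrict (Q n)) := by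
  have h1 := h.aestronglyMeasurable.aemeasurable
  have h2 := fun i => (h.aestronglyMeasurable_deriv i).aemeasurable
  unfold energyDensity
  fun_prop

/-- Tonelli, with the chosen derivatives replaced by `G` almost everywhere. All later work on the
functional goes through this single integral. -/
lemma Rep.J_eq {u₀ : EuclideanSpace ℝ (Fin n) → ℝ} {w : SpaceTime n → ℝ}
    {G : Option (Fin n) → SpaceTime n → ℝ} (h : Rep u₀ w G) {γ ε : ℝ} (hε : 0 < ε) :
    J γ ε w = ∫⁻ z in Q n, ENNReal.ofReal (energyDensity γ ε w G z) := by
  have hD : ∀ i, weakDeriv (Q n) w (dir i) =ᵐ[volume.restrict (Q n)] G i := fun i =>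
    (h.hasWeakDeriv i).weakDeriv_ae_eq isOpen_Q
  let A : SpaceTime n → ℝ≥0∞ := fun z => ENNReal.ofReal ((weakDt w z) ^ 2 + ε * weakGradSq w z)
  let B : SpaceTime n → ℝ≥0∞ := fun z => ENNReal.ofReal ((max (w z) 0) ^ γ)
  have hwm := h.aestronglyMeasurable.aemeasurable
  have hDm : ∀ i, AEMeasurable (weakDeriv (Q n) w (dir i)) (volume.restrict (Q n)) := fun i =>
    (h.aestronglyMeasurable_deriv i).aemeasurable.congr (hD i).symm
  have hA : AEMeasurable A (volume.prod (volume.restrict (Ioi (0 : ℝ)))) := by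
    rw [← volume_restrict_Q]
    refine AEMeasurable.ennreal_ofReal (((hDm none).pow_const 2).add
      (AEMeasurable.const_mul ?_ ε))
    exact Finset.aemeasurable_fun_sum _ fun i _ => (hDm (some i)).pow_const 2
  have hB : AEMeasurable B (volume.prod (volume.restrict (Ioi (0 : ℝ)))) := by
    rw [← volume_restrict_Q]
    fun_prop
  -- Splitting the inner integral in `x` needs measurability of almost every time slice.
  have hAt : ∀ᵐ t ∂(volume.restrict (Ioi (0 : ℝ))), AEMeasurable (fun x => A (x, t)) volume := by
    filter_upwards [hA.aestronglyMeasurable.prod_swap.prodMk_left] with t ht using ht.aemeasurable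
  calc J γ ε w = ∫⁻ t in Ioi (0 : ℝ), ∫⁻ x : EuclideanSpace ℝ (Fin n),
        ENNReal.ofReal (Real.exp (-t)) * (A (x, t) + ENNReal.ofReal (2 * ε) * B (x, t)) := by
        refine lintegral_congr_ae ?_
        filter_upwards [hAt] with t ht
        rw [lintegral_const_mul' _ _ ENNReal.ofReal_ne_top, lintegral_add_left' ht,
          lintegral_const_mul' _ _ ENNReal.ofReal_ne_top]
    _ = ∫⁻ z in Q n, ENNReal.ofReal (Real.exp (-z.2)) * (A z + ENNReal.ofReal (2 * ε) * B z) := by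
        rw [volume_restrict_Q, lintegral_prod_symm]
        exact AEMeasurable.mul (by fun_prop) (hA.add (hB.const_mul _))
    _ = _ := by
        refine lintegral_congr_ae ?_
        have hD' : ∀ᵐ z ∂(volume.restrict (Q n)), ∀ i, weakDeriv (Q n) w (dir i) z = G i z :=
          ae_all_iff.2 hD
        filter_upwards [hD'] with z hz
        have e1 : weakDt w z = G none z := hz none
        have e2 : weakGradSq w z = ∑ i : Fin n, (G (some i) z) ^ 2 :=
          Finset.sum_congr rfl fun i _ => by rw [← hz (some i)]; rfl
        simp only [A, B, e1, e2, energyDensity]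
        have p1 : 0 ≤ ∑ i : Fin n, (G (some i) z) ^ 2 := Finset.sum_nonneg fun i _ => sq_nonneg _
        have p2 : 0 ≤ (max (w z) 0) ^ γ := Real.rpow_nonneg (le_max_right _ _) _
        rw [← ENNReal.ofReal_mul (by positivity), ← ENNReal.ofReal_add (by positivity)
          (by positivity), ← ENNReal.ofReal_mul (by positivity)]

end Representation

/-! ### The time-independent competitor -/

section Competitor

open Filter Topology

variable {n : ℕ}

lemma memLp_comp_fst_Qplus {f : EuclideanSpace ℝ (Fin n) → ℝ} (hf : MemLp f 2 volume) (r : ℝ) :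
    MemLp (fun z : SpaceTime n => f z.1) 2 (volume.restrict (Qplus n r)) := by
  have : IsFiniteMeasure ((volume : Measure ℝ).restrict (Ioo 0 (r ^ 2))) :=
    ⟨by simp⟩
  rw [Qplus, volume_restrict_prod]
  exact (hf.restrict _).comp_fst _

/-- For fixed `t` the slice `φ (·, t)` is a test function in space; Fubini does the rest. -/
lemma HasWeakDeriv.comp_fst {u g : EuclideanSpace ℝ (Fin n) → ℝ} {e : EuclideanSpace ℝ (Fin n)}
    (h : HasWeakDeriv univ u e g) :
    HasWeakDeriv univ (fun z : SpaceTime n => u z.1) (e, 0) (fun z => g z.1) := by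
  have hu := (locallyIntegrable_comp_fst (locallyIntegrableOn_univ.1 h.1)).locallyIntegrableOn univ
  have hg := (locallyIntegrable_comp_fst (locallyIntegrableOn_univ.1 h.2)).locallyIntegrableOn univ
  refine .of_integral hu hg fun φ hφ => ?_
  have i1 := integrable_mul_of_tsupport_subset hu (hφ.continuous_fderiv (e, 0))
    (hφ.hasCompactSupport_fderiv _) (subset_univ _)
  have i2 := integrable_mul_of_tsupport_subset hg hφ.smooth.continuous hφ.compact (subset_univ _)
  rw [Measure.volume_eq_prod] at i1 i2 ⊢
  rw [integral_prod_symm _ i1, integral_prod_symm _ i2, ← integral_neg]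
  refine integral_congr_ae (Eventually.of_forall fun t => ?_)
  have hT : IsTestFunction univ fun x => φ (x, t) := by
    refine ⟨hφ.smooth.comp (contDiff_id.prodMk contDiff_const), ?_, subset_univ _⟩
    refine HasCompactSupport.of_support_subset_isCompact
      (hφ.compact.isCompact.image continuous_fst) ?_
    exact fun x hx => ⟨(x, t), subset_tsupport _ hx, rfl⟩
  have hfd : ∀ x, fderiv ℝ (fun x => φ (x, t)) x e = fderiv ℝ φ (x, t) (e, 0) := by
    intro x
    have h1 : HasFDerivAt φ (fderiv ℝ φ (x, t)) (x, t) :=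
      (hφ.smooth.differentiable (by simp)).differentiableAt.hasFDerivAt
    have h2 := HasFDerivAt.comp x h1 (hasFDerivAt_prodMk_left (𝕜 := ℝ) x t)
    rw [HasFDerivAt.fderiv (f := fun x => φ (x, t)) h2]
    simp
  have := h.integral_mul_fderiv hT
  simpa only [hfd] using this

/-- The integral of `∂ₜφ` along each full time line is zero. -/
lemma hasWeakDeriv_comp_fst_dirT {u : EuclideanSpace ℝ (Fin n) → ℝ} (h : LocallyIntegrable u) :
    HasWeakDeriv univ (fun z : SpaceTime n => u z.1) (dirT n) 0 := by
  have hu := (locallyIntegrable_comp_fst h).locallyIntegrableOn univ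
  refine .of_integral hu locallyIntegrableOn_zero fun φ hφ => ?_
  have i1 := integrable_mul_of_tsupport_subset hu (hφ.continuous_fderiv (dirT n))
    (hφ.hasCompactSupport_fderiv _) (subset_univ _)
  rw [Measure.volume_eq_prod] at i1 ⊢
  rw [integral_prod _ i1]
  simp only [Pi.zero_apply, zero_mul, integral_zero, neg_zero]
  refine integral_eq_zero_of_ae (Eventually.of_forall fun x => ?_)
  dsimp only
  have hcs := HasCompactSupport.slice hφ.compact x
  have hd : deriv (fun s => φ (x, s)) = fun s => fderiv ℝ φ (x, s) (dirT n) :=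
    funext fun s => (hasDerivAt_slice hφ.smooth x s).deriv
  have hcd : Continuous fun s => fderiv ℝ φ (x, s) (dirT n) :=
    (hφ.continuous_fderiv (dirT n)).comp (by fun_prop)
  have h2 := integral_eq_zero_of_hasDerivAt_of_integrable (hasDerivAt_slice hφ.smooth x)
    (hcd.integrable_of_hasCompactSupport (hd ▸ hcs.deriv))
    ((hφ.smooth.continuous.comp (by fun_prop : Continuous fun s : ℝ =>
      (x, s))).integrable_of_hasCompactSupport hcs)
  rw [integral_const_mul, h2, mul_zero, Pi.zero_apply]

/-- Extending `u₀(x)` by its initial datum changes nothing, so the trace condition only says that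
its time derivative is zero. -/
lemma rep_comp_fst {u₀ : EuclideanSpace ℝ (Fin n) → ℝ} (hu₀ : MemLp u₀ 2 volume)
    {g : Fin n → EuclideanSpace ℝ (Fin n) → ℝ} (hg2 : ∀ i, MemLp (g i) 2 volume)
    (hg : ∀ i, HasWeakDeriv univ u₀ (EuclideanSpace.single i 1) (g i)) :
    Rep u₀ (fun z => u₀ z.1) (fun i z => i.elim 0 fun i => g i z.1) := by
  have hT := hasWeakDeriv_comp_fst_dirT (hu₀.locallyIntegrable (by simp))
  refine ⟨fun r _ => memLp_comp_fst_Qplus hu₀ r, fun i r _ => ?_, fun i => ?_, ?_⟩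
  · cases i with
    | none => exact MemLp.zero
    | some i => exact memLp_comp_fst_Qplus (hg2 i) r
  · cases i with
    | none => exact hT.mono (subset_univ _)
    | some i => exact (hg i).comp_fst.mono (subset_univ _)
  · convert hT using 1
    · funext z
      by_cases hz : z ∈ Q n
      · exact initialExt_of_mem hz
      · exact initialExt_of_notMem hz
    · exact indicator_zero _ _

lemma lintegral_exp_neg : ∫⁻ t in Ioi (0 : ℝ), ENNReal.ofReal (Real.exp (-t)) = 1 := by
  rw [← ofReal_integral_eq_lintegral_ofReal (integrableOn_exp_neg_Ioi 0)
    (Eventually.of_forall fun t => (Real.exp_pos _).le), integral_exp_neg_Ioi_zero,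
    ENNReal.ofReal_one]

/-- The energy of the time-independent competitor is of order `ε`. -/
lemma exists_competitor {γ : ℝ} (hγ : 1 ≤ γ) {u₀ : EuclideanSpace ℝ (Fin n) → ℝ}
    (hu₀ : MemH1 univ u₀) (hu₀γ : MemLp u₀ (ENNReal.ofReal γ) volume) :
    ∃ C : ℝ, 0 < C ∧ ∃ w G, Rep u₀ w G ∧ ∀ ε : ℝ, 0 < ε → J γ ε w ≤ ENNReal.ofReal (C * ε) := by
  have h2 : MemLp u₀ 2 volume := by simpa using hu₀.memLp
  choose g hg2 hg using fun i : Fin n => hu₀.exists_weakDeriv (EuclideanSpace.single i 1)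
  simp only [Measure.restrict_univ] at hg2
  have hrep := rep_comp_fst h2 hg2 hg
  let a : EuclideanSpace ℝ (Fin n) → ℝ := fun x =>
    (∑ i, (g i x) ^ 2) + 2 * (max (u₀ x) 0) ^ γ
  have hγ0 : 0 < γ := by linarith
  have hpow : Integrable fun x => (max (u₀ x) 0) ^ γ := by
    have h1 := hu₀γ.integrable_norm_rpow (by simpa using hγ0) (by simp)
    rw [ENNReal.toReal_ofReal hγ0.le] at h1
    refine h1.mono' ?_ (Eventually.of_forall fun x => ?_)
    · have := h2.aestronglyMeasurable.aemeasurable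
      exact AEMeasurable.aestronglyMeasurable (by fun_prop)
    · rw [Real.norm_of_nonneg (Real.rpow_nonneg (le_max_right _ _) _)]
      exact Real.rpow_le_rpow (le_max_right _ _) (max_le (le_abs_self _) (abs_nonneg _)) hγ0.le
  have ha : Integrable a :=
    (integrable_finsetSum _ fun i _ => (hg2 i).integrable_sq).add (hpow.const_mul 2)
  have ha0 : ∀ x, 0 ≤ a x := fun x => by
    have p1 : 0 ≤ ∑ i, (g i x) ^ 2 := Finset.sum_nonneg fun i _ => sq_nonneg _
    have p2 : 0 ≤ (max (u₀ x) 0) ^ γ := Real.rpow_nonneg (le_max_right _ _) _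
    positivity
  -- The energy is exactly `ε ∫ a`, because `e^{-t}` has integral one; the `+ 1` only makes the
  -- constant positive when `∫ a = 0`.
  refine ⟨(∫ x, a x) + 1, by linarith [integral_nonneg (μ := volume) (f := a) ha0], _, _, hrep, fun ε hε => ?_⟩
  rw [hrep.J_eq hε]
  have hd : ∀ z : SpaceTime n, ENNReal.ofReal (energyDensity γ ε (fun z => u₀ z.1)
      (fun i z => i.elim 0 fun i => g i z.1) z) =
      ENNReal.ofReal (ε * a z.1) * ENNReal.ofReal (Real.exp (-z.2)) := by
    intro z
    rw [← ENNReal.ofReal_mul (mul_nonneg hε.le (ha0 _))]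
    congr 1
    simp only [energyDensity, Option.elim_none, Option.elim_some, a]
    ring
  have ham : AEMeasurable (fun x => ENNReal.ofReal (ε * a x)) :=
    (ha.const_mul ε).aestronglyMeasurable.aemeasurable.ennreal_ofReal
  simp only [hd]
  rw [volume_restrict_Q, lintegral_prod]
  · simp only
    have : ∀ x, ∫⁻ t in Ioi (0 : ℝ), ENNReal.ofReal (ε * a x) * ENNReal.ofReal (Real.exp (-t)) =
        ENNReal.ofReal (ε * a x) := fun x => by
      rw [lintegral_const_mul' _ _ ENNReal.ofReal_ne_top, lintegral_exp_neg, mul_one]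
    simp only [this]
    rw [← ofReal_integral_eq_lintegral_ofReal (ha.const_mul ε)
      (Eventually.of_forall fun x => mul_nonneg hε.le (ha0 x)), integral_const_mul]
    exact ENNReal.ofReal_le_ofReal (by linarith)
  · exact ham.comp_fst.mul (by fun_prop)

end Competitor

/-! ### Convexity and closeness of almost minimizers -/

section Convexity

open Filter Topology

variable {n : ℕ} {u₀ : EuclideanSpace ℝ (Fin n) → ℝ} {w w' : SpaceTime n → ℝ}
  {G G' : Option (Fin n) → SpaceTime n → ℝ}

lemma Rep.midpoint (h : Rep u₀ w G) (h' : Rep u₀ w' G') :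
    Rep u₀ (fun z => 1 / 2 * (w z + w' z)) (fun i z => 1 / 2 * (G i z + G' i z)) := by
  refine ⟨fun r hr => ((h.memLp r hr).add (h'.memLp r hr)).const_mul _,
    fun i r hr => ((h.memLp_deriv i r hr).add (h'.memLp_deriv i r hr)).const_mul _,
    fun i => ((h.hasWeakDeriv i).add (h'.hasWeakDeriv i)).const_mul _, ?_⟩
  convert (h.trace.add h'.trace).const_mul (1 / 2) using 1
  · funext z
    by_cases hz : z ∈ Q n
    · simp only [initialExt_of_mem hz]
    · simp only [initialExt_of_notMem hz]; ring
  · funext z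
    by_cases hz : z ∈ Q n <;> simp [hz]

/-- The quadratic part of the energy density. -/
noncomputable def quadDensity (ε : ℝ) (G : Option (Fin n) → SpaceTime n → ℝ) (z : SpaceTime n) :
    ℝ :=
  Real.exp (-z.2) * ((G none z) ^ 2 + ε * ∑ i : Fin n, (G (some i) z) ^ 2)

lemma rpow_max_midpoint_le {γ : ℝ} (hγ : 1 ≤ γ) (a b : ℝ) :
    2 * (max (1 / 2 * (a + b)) 0) ^ γ ≤ (max a 0) ^ γ + (max b 0) ^ γ := by
  have h1 := (convexOn_rpow hγ).2 (mem_Ici.2 (le_max_right a 0)) (mem_Ici.2 (le_max_right b 0))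
    (by norm_num : (0 : ℝ) ≤ 1 / 2) (by norm_num : (0 : ℝ) ≤ 1 / 2) (by norm_num)
  simp only [smul_eq_mul] at h1
  have h2 : (max (1 / 2 * (a + b)) 0) ^ γ ≤ (1 / 2 * max a 0 + 1 / 2 * max b 0) ^ γ := by
    refine Real.rpow_le_rpow (le_max_right _ _) (max_le ?_ ?_) (by linarith)
    · linarith [le_max_left a 0, le_max_left b 0]
    · linarith [le_max_right a 0, le_max_right b 0]
  linarith

/-- The parallelogram identity gives the quadratic gain with constant `2 · 1/4`; the power term is
merely convex and contributes no gain. -/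
lemma energyDensity_midpoint_add_le {γ ε : ℝ} (hγ : 1 ≤ γ) (hε : 0 < ε) (z : SpaceTime n) :
    2 * energyDensity γ ε (fun z => 1 / 2 * (w z + w' z)) (fun i z => 1 / 2 * (G i z + G' i z)) z +
      1 / 2 * quadDensity ε (fun i z => G i z - G' i z) z ≤
      energyDensity γ ε w G z + energyDensity γ ε w' G' z := by
  have h1 := mul_le_mul_of_nonneg_left (rpow_max_midpoint_le hγ (w z) (w' z))
    (by positivity : 0 ≤ 2 * ε * Real.exp (-z.2))
  have h2 : ∀ x y : ℝ, (1 / 2 * (x + y)) ^ 2 = 1 / 2 * x ^ 2 + 1 / 2 * y ^ 2 -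
      1 / 4 * (x - y) ^ 2 := fun x y => by ring
  simp only [energyDensity, quadDensity, h2, Finset.sum_add_distrib, Finset.sum_sub_distrib,
    ← Finset.mul_sum]
  linarith

lemma energyDensity_nonneg {γ ε : ℝ} (hε : 0 < ε) (z : SpaceTime n) :
    0 ≤ energyDensity γ ε w G z := by
  have p1 : 0 ≤ ∑ i : Fin n, (G (some i) z) ^ 2 := Finset.sum_nonneg fun i _ => sq_nonneg _
  have p2 : 0 ≤ (max (w z) 0) ^ γ := Real.rpow_nonneg (le_max_right _ _) _
  unfold energyDensity
  positivity

lemma quadDensity_nonneg {ε : ℝ} (hε : 0 < ε) (z : SpaceTime n) : 0 ≤ quadDensity ε G z := by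
  have p1 : 0 ≤ ∑ i : Fin n, (G (some i) z) ^ 2 := Finset.sum_nonneg fun i _ => sq_nonneg _
  unfold quadDensity
  positivity

lemma Rep.two_mul_J_midpoint_add_le (h : Rep u₀ w G) (h' : Rep u₀ w' G') {γ ε : ℝ} (hγ : 1 ≤ γ)
    (hε : 0 < ε) :
    ENNReal.ofReal 2 * J γ ε (fun z => 1 / 2 * (w z + w' z)) + ENNReal.ofReal (1 / 2) *
      ∫⁻ z in Q n, ENNReal.ofReal (quadDensity ε (fun i z => G i z - G' i z) z) ≤ J γ ε w + J γ ε w' := by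
  rw [(h.midpoint h').J_eq hε, h.J_eq hε, h'.J_eq hε,
    ← lintegral_const_mul' _ _ ENNReal.ofReal_ne_top,
    ← lintegral_const_mul' _ _ ENNReal.ofReal_ne_top, ← lintegral_add_left',
    ← lintegral_add_left']
  · refine lintegral_mono fun z => ?_
    rw [← ENNReal.ofReal_mul (by norm_num), ← ENNReal.ofReal_mul (by norm_num),
      ← ENNReal.ofReal_add, ← ENNReal.ofReal_add (energyDensity_nonneg hε z)
      (energyDensity_nonneg hε z)]
    · exact ENNReal.ofReal_le_ofReal (energyDensity_midpoint_add_le hγ hε z)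
    · exact mul_nonneg (by norm_num) (energyDensity_nonneg hε z)
    · exact mul_nonneg (by norm_num) (quadDensity_nonneg hε z)
  · exact (h.aemeasurable_energyDensity γ ε).ennreal_ofReal
  · exact ((h.midpoint h').aemeasurable_energyDensity γ ε).ennreal_ofReal.const_mul _

/-- Almost minimizers are close to each other in energy. -/
lemma Rep.lintegral_quadDensity_sub_le (h : Rep u₀ w G) (h' : Rep u₀ w' G')
    (hu₀ : LocallyIntegrable u₀) {γ ε : ℝ} (hγ : 1 ≤ γ)
    (hε : 0 < ε) {m δ : ℝ≥0∞} (hm : m ≠ ⊤) (hmin : ∀ w ∈ U0 u₀, m ≤ J γ ε w)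
    (hw : J γ ε w ≤ m + δ) (hw' : J γ ε w' ≤ m + δ) :
    ∫⁻ z in Q n, ENNReal.ofReal (quadDensity ε (fun i z => G i z - G' i z) z) ≤ 4 * δ := by
  set q := ∫⁻ z in Q n, ENNReal.ofReal (quadDensity ε (fun i z => G i z - G' i z) z)
  -- The midpoint is again admissible, so its energy is at least `m`. As `m` is finite, `2 * m`
  -- cancels and `q / 2 ≤ 2 δ` remains.
  have h1 : 2 * m + ENNReal.ofReal (1 / 2) * q ≤ 2 * m + 2 * δ := by
    calc _ ≤ ENNReal.ofReal 2 * J γ ε (fun z => 1 / 2 * (w z + w' z)) + ENNReal.ofReal (1 / 2) * q := by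
          rw [ENNReal.ofReal_ofNat]
          gcongr
          exact hmin _ ((h.midpoint h').mem_U0 hu₀)
      _ ≤ _ := h.two_mul_J_midpoint_add_le h' hγ hε
      _ ≤ (m + δ) + (m + δ) := add_le_add hw hw'
      _ = _ := by ring
  have h2 := (ENNReal.add_le_add_iff_left (ENNReal.mul_ne_top (by simp) hm)).1 h1
  calc q = 2 * (ENNReal.ofReal (1 / 2) * q) := by
        rw [← mul_assoc, ← ENNReal.ofReal_ofNat, ← ENNReal.ofReal_mul (by norm_num)]
        norm_num
    _ ≤ 2 * (2 * δ) := by gcongr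
    _ = 4 * δ := by rw [← mul_assoc]; norm_num

/-- The time derivative enters with weight `1 > ε` and each space derivative with weight `ε`, so `ε`
serves for all directions. -/
lemma mul_lintegral_exp_sq_le_quadDensity {ε : ℝ} (hε : 0 < ε) (hε1 : ε < 1)
    (G : Option (Fin n) → SpaceTime n → ℝ) (i : Option (Fin n)) :
    ENNReal.ofReal ε * ∫⁻ z in Q n, ‖Real.exp (-z.2 / 2) * G i z‖ₑ ^ 2 ≤
      ∫⁻ z in Q n, ENNReal.ofReal (quadDensity ε G z) := by
  rw [← lintegral_const_mul' _ _ ENNReal.ofReal_ne_top]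
  refine lintegral_mono fun z => ?_
  dsimp only
  rw [← ofReal_norm, ← ENNReal.ofReal_pow (norm_nonneg _), ← ENNReal.ofReal_mul hε.le]
  refine ENNReal.ofReal_le_ofReal ?_
  have he : Real.exp (-z.2 / 2) ^ 2 = Real.exp (-z.2) := by
    rw [← Real.exp_nat_mul]; congr 1; push_cast; ring
  rw [Real.norm_eq_abs, sq_abs, mul_pow, he, quadDensity, mul_left_comm]
  refine mul_le_mul_of_nonneg_left ?_ (Real.exp_pos _).le
  have p1 : 0 ≤ ∑ i : Fin n, (G (some i) z) ^ 2 := Finset.sum_nonneg fun i _ => sq_nonneg _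
  cases i with
  | none => nlinarith [sq_nonneg (G none z), mul_nonneg hε.le p1]
  | some i =>
    have := Finset.single_le_sum (f := fun i => (G (some i) z) ^ 2) (fun i _ => sq_nonneg _)
      (Finset.mem_univ i)
    nlinarith [sq_nonneg (G none z), mul_le_mul_of_nonneg_left this hε.le]

/-- Both extensions equal `u₀` for `t ≤ 0`, so their difference vanishes there and the Poincaré
inequality applies. -/
lemma Rep.lintegral_exp_sq_sub_le (h : Rep u₀ w G) (h' : Rep u₀ w' G') :
    ∫⁻ z in Q n, ‖Real.exp (-z.2) * (w z - w' z)‖ₑ ^ 2 ≤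
      ∫⁻ z in Q n, ‖Real.exp (-z.2 / 2) * (G none z - G' none z)‖ₑ ^ 2 := by
  have hQ : MeasurableSet (Q n) := isOpen_Q.measurableSet
  have hn : ∀ z : SpaceTime n, z.2 ≤ 0 → z ∉ Q n := fun z hz hzQ => not_lt.2 hz hzQ.2
  have := lintegral_exp_sq_le (h.trace.sub h'.trace)
    (fun z hz => by simp only [initialExt_of_notMem (hn z hz), sub_self])
    (fun z hz => by simp only [indicator_of_notMem (hn z hz), sub_self])
  convert this using 1
  · exact setLIntegral_congr_fun hQ fun z hz => by simp only [initialExt_of_mem hz]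
  · exact setLIntegral_congr_fun hQ fun z hz => by simp only [indicator_of_mem hz]

end Convexity

/-! ### Limits in weighted `L²` -/

section Limits

open Filter Topology

variable {n : ℕ}

lemma eLpNorm_two_sq {α : Type*} [MeasurableSpace α] (μ : Measure α) (f : α → ℝ) :
    eLpNorm f 2 μ ^ 2 = ∫⁻ x, ‖f x‖ₑ ^ 2 ∂μ := by
  simpa using eLpNorm_nnreal_pow_eq_lintegral (μ := μ) (f := f) (p := 2) (by simp)

/-- Completeness of `L²` applied to `a * f k`, then division by `a`. The summable Cauchy rate makes
the whole sequence converge almost everywhere. -/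
lemma exists_weighted_limit {a : SpaceTime n → ℝ} (ha : Continuous a) (ha0 : ∀ z, 0 < a z)
    {f : ℕ → SpaceTime n → ℝ} (hf : ∀ k, AEStronglyMeasurable (f k) (volume.restrict (Q n)))
    (hcau : ∀ N k l : ℕ, N ≤ k → N ≤ l →
      ∫⁻ z in Q n, ‖a z * (f k z - f l z)‖ₑ ^ 2 ≤ ENNReal.ofReal ((1 / 2) ^ N / 2) ^ 2) :
    ∃ F, AEStronglyMeasurable F (volume.restrict (Q n)) ∧
      (∀ᵐ z ∂(volume.restrict (Q n)), Tendsto (fun k => f k z) atTop (𝓝 (F z))) ∧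
      Tendsto (fun k => eLpNorm (fun z => a z * (f k z - F z)) 2 (volume.restrict (Q n))) atTop
        (𝓝 0) := by
  let h : ℕ → SpaceTime n → ℝ := fun k z => a z * f k z
  let B : ℕ → ℝ≥0∞ := fun N => ENNReal.ofReal ((1 / 2) ^ N)
  have hh : ∀ k, AEStronglyMeasurable (h k) (volume.restrict (Q n)) := fun k =>
    ha.aestronglyMeasurable.mul (hf k)
  have hB : ∑' N, B N ≠ ⊤ := summable_geometric_two.tsum_ofReal_ne_top
  have hc : ∀ N k l : ℕ, N ≤ k → N ≤ l →
      eLpNorm (h k - h l) 2 (volume.restrict (Q n)) < B N := by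
    intro N k l hk hl
    have e : h k - h l = fun z => a z * (f k z - f l z) := by
      funext z; simp only [h, Pi.sub_apply]; ring
    have h1 := hcau N k l hk hl
    rw [← eLpNorm_two_sq, ← e] at h1
    -- The factor `1/2` in the assumed rate provides the strict inequality.
    refine ((ENNReal.pow_le_pow_left_iff two_ne_zero).1 h1).trans_lt ?_
    rw [ENNReal.ofReal_lt_ofReal_iff (by positivity)]
    have : (0 : ℝ) < (1 / 2) ^ N := by positivity
    linarith
  obtain ⟨H, hHm, hH⟩ := exists_stronglyMeasurable_limit_of_tendsto_ae hh
    (Lp.ae_tendsto_of_cauchy_eLpNorm hh (by norm_num) hB hc)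
  have hlim := Lp.cauchy_tendsto_of_tendsto hh H hB hc hH
  have hinv : Continuous fun z => (a z)⁻¹ := ha.inv₀ fun z => (ha0 z).ne'
  refine ⟨fun z => (a z)⁻¹ * H z, hinv.aestronglyMeasurable.mul hHm.aestronglyMeasurable, ?_, ?_⟩
  · filter_upwards [hH] with z hz
    refine (hz.const_mul (a z)⁻¹).congr fun k => ?_
    simp only [h]
    rw [inv_mul_cancel_left₀ (ha0 z).ne']
  · refine hlim.congr fun k => ?_
    congr 1
    funext z
    simp only [h, Pi.sub_apply, mul_sub]
    rw [mul_inv_cancel_left₀ (ha0 z).ne']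

/-- The weight is bounded away from zero on a bounded cylinder. -/
lemma memLp_Qplus_of_weighted {a h : SpaceTime n → ℝ} (ha : Continuous a) (ha0 : ∀ z, 0 < a z)
    (hm : AEStronglyMeasurable h (volume.restrict (Q n)))
    (hh : MemLp (fun z => a z * h z) 2 (volume.restrict (Q n))) (r : ℝ) :
    MemLp h 2 (volume.restrict (Qplus n r)) := by
  have hinv : Continuous fun z => (a z)⁻¹ := ha.inv₀ fun z => (ha0 z).ne'
  obtain ⟨C, hC⟩ := ((isBounded_Qplus (n := n) r).isCompact_closure).exists_bound_of_continuousOn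
    hinv.continuousOn
  have h1 := hh.mono_measure (Measure.restrict_mono (Qplus_subset_Q r) le_rfl)
  refine h1.of_le_mul (c := C) (hm.mono_set (Qplus_subset_Q r)) ?_
  filter_upwards [ae_restrict_mem (isOpen_Qplus r).measurableSet] with z hz
  have h2 := hC z (subset_closure hz)
  calc ‖h z‖ = ‖(a z)⁻¹‖ * ‖a z * h z‖ := by
        rw [← norm_mul, inv_mul_cancel_left₀ (ha0 z).ne']
    _ ≤ C * ‖a z * h z‖ := by gcongr

lemma memLp_Qplus_of_weighted_limit {a F : SpaceTime n → ℝ} (ha : Continuous a)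
    (ha0 : ∀ z, 0 < a z) {f : ℕ → SpaceTime n → ℝ}
    (hf : ∀ k, AEStronglyMeasurable (f k) (volume.restrict (Q n)))
    (hf2 : ∀ k, ∀ r : ℝ, 0 < r → MemLp (f k) 2 (volume.restrict (Qplus n r)))
    (hF : AEStronglyMeasurable F (volume.restrict (Q n)))
    (hlim : Tendsto (fun k => eLpNorm (fun z => a z * (f k z - F z)) 2 (volume.restrict (Q n)))
      atTop (𝓝 0)) (r : ℝ) (hr : 0 < r) : MemLp F 2 (volume.restrict (Qplus n r)) := by
  obtain ⟨k, hk⟩ := (hlim.eventually (gt_mem_nhds ENNReal.zero_lt_top)).exists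
  have h1 := memLp_Qplus_of_weighted ha ha0 ((hf k).sub hF)
    ⟨ha.aestronglyMeasurable.mul ((hf k).sub hF), hk⟩ r
  simpa using! (hf2 k r hr).sub h1

/-- Cauchy–Schwarz, pairing `a * (f k - F)` with `a⁻¹ * ψ`, which lies in `L²` because `ψ` has
compact support. The support may cross `t = 0`, as the trace condition requires. -/
lemma tendsto_integral_mul_of_weighted_limit {a F ψ : SpaceTime n → ℝ} (ha : Continuous a)
    (ha0 : ∀ z, 0 < a z) {f : ℕ → SpaceTime n → ℝ}
    (hf : ∀ k, LocallyIntegrable ((Q n).indicator (f k)))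
    (hF : LocallyIntegrable ((Q n).indicator F))
    (hlim : Tendsto (fun k => eLpNorm (fun z => a z * (f k z - F z)) 2 (volume.restrict (Q n)))
      atTop (𝓝 0)) (hψ : Continuous ψ) (hc : HasCompactSupport ψ) :
    Tendsto (fun k => ∫ z, (Q n).indicator (f k) z * ψ z) atTop
      (𝓝 (∫ z, (Q n).indicator F z * ψ z)) := by
  have hQ : MeasurableSet (Q n) := isOpen_Q.measurableSet
  have hinv : Continuous fun z => (a z)⁻¹ := ha.inv₀ fun z => (ha0 z).ne'
  have hi : ∀ {h : SpaceTime n → ℝ}, LocallyIntegrable ((Q n).indicator h) →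
      Integrable fun z => (Q n).indicator h z * ψ z := fun hh =>
    integrable_mul_of_tsupport_subset (hh.locallyIntegrableOn univ) hψ hc (subset_univ _)
  have hm : ∀ {h : SpaceTime n → ℝ}, LocallyIntegrable ((Q n).indicator h) →
      AEStronglyMeasurable h (volume.restrict (Q n)) := fun hh =>
    (aestronglyMeasurable_indicator_iff hQ).1 hh.aestronglyMeasurable
  have hψ2 : MemLp (fun z => (a z)⁻¹ * ψ z) 2 (volume.restrict (Q n)) :=
    ((hinv.mul hψ).memLp_of_hasCompactSupport (p := 2) (μ := volume) hc.mul_left).restrict _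
  refine tendsto_integral_of_L1 _ (hi hF).aestronglyMeasurable
    (Eventually.of_forall fun k => hi (hf k)) ?_
  have hz := ENNReal.Tendsto.mul_const
    (b := eLpNorm (fun z => (a z)⁻¹ * ψ z) 2 (volume.restrict (Q n))) hlim
    (Or.inr hψ2.2.ne)
  rw [zero_mul] at hz
  refine tendsto_of_tendsto_of_tendsto_of_le_of_le tendsto_const_nhds hz (fun _ => zero_le)
    fun k => ?_
  let φ : SpaceTime n → ℝ := fun z => a z * (f k z - F z)
  have hφ : AEStronglyMeasurable φ (volume.restrict (Q n)) :=
    ha.aestronglyMeasurable.mul ((hm (hf k)).sub (hm hF))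
  have e1 : ∀ z, ‖(Q n).indicator (f k) z * ψ z - (Q n).indicator F z * ψ z‖ₑ =
      (Q n).indicator (fun z => ‖(φ • fun z => (a z)⁻¹ * ψ z) z‖ₑ) z := by
    intro z
    by_cases hz : z ∈ Q n
    · rw [indicator_of_mem hz, indicator_of_mem hz, indicator_of_mem hz, ← sub_mul]
      congr 1
      simp only [φ, Pi.smul_apply', smul_eq_mul]
      have := (ha0 z).ne'
      field_simp
    · simp [hz]
  calc ∫⁻ z, ‖(Q n).indicator (f k) z * ψ z - (Q n).indicator F z * ψ z‖ₑ
      = ∫⁻ z in Q n, ‖(φ • fun z => (a z)⁻¹ * ψ z) z‖ₑ := by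
        rw [← lintegral_indicator hQ]
        exact lintegral_congr e1
    _ = eLpNorm (φ • fun z => (a z)⁻¹ * ψ z) 1 (volume.restrict (Q n)) :=
        eLpNorm_one_eq_lintegral_enorm.symm
    _ ≤ _ := eLpNorm_smul_le_mul_eLpNorm (p := 2) (q := 2) hψ2.1 hφ

end Limits

/-! ### Existence, uniqueness and sign of the minimizer -/

section Minimizer

open Filter Topology

variable {n : ℕ} {u₀ : EuclideanSpace ℝ (Fin n) → ℝ}

/-- Being a weak derivative is closed under such limits. For the trace the same fact is used on all
of space-time: the extensions differ from the indicators on `Q n` by the fixed term coming from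
`u₀`. -/
lemma Rep.of_weighted_limit (hu₀ : LocallyIntegrable u₀) {a b : SpaceTime n → ℝ}
    (ha : Continuous a) (ha0 : ∀ z, 0 < a z) (hb : Continuous b) (hb0 : ∀ z, 0 < b z)
    {w : ℕ → SpaceTime n → ℝ} {G : ℕ → Option (Fin n) → SpaceTime n → ℝ}
    (h : ∀ k, Rep u₀ (w k) (G k)) {v : SpaceTime n → ℝ} {H : Option (Fin n) → SpaceTime n → ℝ}
    (hv : AEStronglyMeasurable v (volume.restrict (Q n)))
    (hH : ∀ i, AEStronglyMeasurable (H i) (volume.restrict (Q n)))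
    (hvlim : Tendsto (fun k => eLpNorm (fun z => a z * (w k z - v z)) 2 (volume.restrict (Q n)))
      atTop (𝓝 0))
    (hHlim : ∀ i, Tendsto (fun k => eLpNorm (fun z => b z * (G k i z - H i z)) 2
      (volume.restrict (Q n))) atTop (𝓝 0)) : Rep u₀ v H := by
  have hv2 := memLp_Qplus_of_weighted_limit ha ha0 (fun k => (h k).aestronglyMeasurable)
    (fun k => (h k).memLp) hv hvlim
  have hH2 := fun i => memLp_Qplus_of_weighted_limit hb hb0
    (fun k => (h k).aestronglyMeasurable_deriv i) (fun k => (h k).memLp_deriv i) (hH i) (hHlim i)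
  have lv : ∀ ψ : SpaceTime n → ℝ, Continuous ψ → HasCompactSupport ψ →
      Tendsto (fun k => ∫ z, (Q n).indicator (w k) z * ψ z) atTop
      (𝓝 (∫ z, (Q n).indicator v z * ψ z)) := fun ψ =>
    tendsto_integral_mul_of_weighted_limit ha ha0
      (fun k => locallyIntegrable_indicator_Q (h k).memLp) (locallyIntegrable_indicator_Q hv2) hvlim
  have lH : ∀ i, ∀ ψ : SpaceTime n → ℝ, Continuous ψ → HasCompactSupport ψ →
      Tendsto (fun k => ∫ z, (Q n).indicator (G k i) z * ψ z) atTop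
      (𝓝 (∫ z, (Q n).indicator (H i) z * ψ z)) := fun i ψ =>
    tendsto_integral_mul_of_weighted_limit hb hb0
      (fun k => locallyIntegrable_indicator_Q ((h k).memLp_deriv i))
      (locallyIntegrable_indicator_Q (hH2 i)) (hHlim i)
  have ind : ∀ (f ψ : SpaceTime n → ℝ), tsupport ψ ⊆ Q n →
      ∫ z, (Q n).indicator f z * ψ z = ∫ z, f z * ψ z := by
    intro f ψ hψ
    refine integral_congr_ae (Eventually.of_forall fun z => ?_)
    by_cases hz : z ∈ Q n
    · simp only [indicator_of_mem hz]
    · simp only [image_eq_zero_of_notMem_tsupport fun hz' => hz (hψ hz'), mul_zero]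
  refine ⟨hv2, hH2, fun i => ?_, ?_⟩
  · refine .of_tendsto (fun k => (h k).hasWeakDeriv i) (locallyIntegrableOn_Q hv2)
      (locallyIntegrableOn_Q (hH2 i)) (fun ψ h1 h2 h3 => ?_) (fun ψ h1 h2 h3 => ?_)
    · simpa only [ind _ ψ h3] using lv ψ h1 h2
    · simpa only [ind _ ψ h3] using lH i ψ h1 h2
  · have hc : LocallyIntegrable ((Q n)ᶜ.indicator fun z : SpaceTime n => u₀ z.1) :=
      (locallyIntegrable_comp_fst hu₀).indicator isOpen_Q.measurableSet.compl
    have hext : ∀ {f : SpaceTime n → ℝ}, LocallyIntegrable ((Q n).indicator f) →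
        ∀ ψ : SpaceTime n → ℝ, Continuous ψ → HasCompactSupport ψ →
        ∫ z, initialExt f u₀ z * ψ z = (∫ z, (Q n).indicator f z * ψ z) +
          ∫ z, (Q n)ᶜ.indicator (fun z : SpaceTime n => u₀ z.1) z * ψ z := by
      intro f hf ψ h1 h2
      rw [← integral_add]
      · simp only [initialExt, add_mul]
      · exact integrable_mul_of_tsupport_subset (hf.locallyIntegrableOn univ) h1 h2
          (subset_univ _)
      · exact integrable_mul_of_tsupport_subset (hc.locallyIntegrableOn univ) h1 h2
          (subset_univ _)
    refine .of_tendsto (fun k => (h k).trace)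
      (((locallyIntegrable_indicator_Q hv2).add hc).locallyIntegrableOn univ)
      ((locallyIntegrable_indicator_Q (hH2 none)).locallyIntegrableOn univ)
      (fun ψ h1 h2 _ => ?_) (fun ψ h1 h2 _ => lH none ψ h1 h2)
    have := (lv ψ h1 h2).add_const
      (∫ z, (Q n)ᶜ.indicator (fun z : SpaceTime n => u₀ z.1) z * ψ z)
    rw [← hext (locallyIntegrable_indicator_Q hv2) ψ h1 h2] at this
    exact this.congr fun k => (hext (locallyIntegrable_indicator_Q (h k).memLp) ψ h1 h2).symm

/-- The energy gap is measured in units of `ε`, so that `ε` cancels and the bound is uniform in `ε`.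
-/
lemma Rep.lintegral_weighted_deriv_sub_le {w w' : SpaceTime n → ℝ}
    {G G' : Option (Fin n) → SpaceTime n → ℝ} (h : Rep u₀ w G) (h' : Rep u₀ w' G')
    (hu₀ : LocallyIntegrable u₀) {γ ε : ℝ} (hγ : 1 ≤ γ)
    (hε : 0 < ε) (hε1 : ε < 1) {m δ : ℝ≥0∞} (hm : m ≠ ⊤) (hmin : ∀ w ∈ U0 u₀, m ≤ J γ ε w)
    (hw : J γ ε w ≤ m + ENNReal.ofReal ε * δ) (hw' : J γ ε w' ≤ m + ENNReal.ofReal ε * δ)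
    (i : Option (Fin n)) :
    ∫⁻ z in Q n, ‖Real.exp (-z.2 / 2) * (G i z - G' i z)‖ₑ ^ 2 ≤ 4 * δ := by
  have h1 := (mul_lintegral_exp_sq_le_quadDensity hε hε1 (fun i z => G i z - G' i z) i).trans
    (h.lintegral_quadDensity_sub_le h' hu₀ hγ hε hm hmin hw hw')
  rw [mul_left_comm] at h1
  exact (ENNReal.mul_le_mul_iff_right (by simpa using hε) ENNReal.ofReal_ne_top).1 h1

/-- Two minimizers agree almost everywhere. -/
lemma IsMinimizer.ae_eq (hu₀ : LocallyIntegrable u₀) {γ ε : ℝ} (hγ : 1 ≤ γ) (hε : 0 < ε)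
    (hε1 : ε < 1) {v w : SpaceTime n → ℝ} (hv : IsMinimizer γ ε u₀ v)
    (hw : IsMinimizer γ ε u₀ w) (hfin : J γ ε v ≠ ⊤) : w =ᵐ[volume.restrict (Q n)] v := by
  obtain ⟨G, hG⟩ := exists_rep_of_mem_U0 hu₀ hw.1
  obtain ⟨H, hH⟩ := exists_rep_of_mem_U0 hu₀ hv.1
  have h1 := hG.lintegral_weighted_deriv_sub_le hH hu₀ hγ hε hε1 (δ := 0) hfin hv.2
    (by simpa using hw.2 v hv.1) (by simp) none
  have h2 := (hG.lintegral_exp_sq_sub_le hH).trans h1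
  rw [mul_zero, nonpos_iff_eq_zero, lintegral_eq_zero_iff'] at h2
  · filter_upwards [h2] with z hz
    have := (Real.exp_pos (-z.2)).ne'
    simp only [Pi.zero_apply, pow_eq_zero_iff two_ne_zero, enorm_eq_zero, mul_eq_zero, this,
      false_or] at hz
    exact sub_eq_zero.1 hz
  · exact ((by fun_prop : Continuous fun z : SpaceTime n =>
      Real.exp (-z.2)).aestronglyMeasurable.mul
      (hG.aestronglyMeasurable.sub hH.aestronglyMeasurable)).enorm.pow_const 2

/-- Existence of minimizers by the direct method. -/
lemma exists_isMinimizer (hu₀ : LocallyIntegrable u₀) {γ ε : ℝ} (hγ : 1 ≤ γ) (hε : 0 < ε)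
    (hε1 : ε < 1) {w₁ : SpaceTime n → ℝ} (hw₁ : w₁ ∈ U0 u₀) (hfin : J γ ε w₁ ≠ ⊤) :
    ∃ v, IsMinimizer γ ε u₀ v := by
  set m : ℝ≥0∞ := sInf (J γ ε '' U0 u₀) with hmdef
  have hmin : ∀ w ∈ U0 u₀, m ≤ J γ ε w := fun w hw => sInf_le (mem_image_of_mem _ hw)
  have hm : m ≠ ⊤ := ne_top_of_le_ne_top hfin (hmin w₁ hw₁)
  -- Chosen so that `4 * δ k` is exactly the Cauchy rate required by `exists_weighted_limit`.
  let δ : ℕ → ℝ≥0∞ := fun k => ENNReal.ofReal ((1 / 2) ^ k / 4) ^ 2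
  have hδ4 : ∀ k, 4 * δ k = ENNReal.ofReal ((1 / 2) ^ k / 2) ^ 2 := fun k => by
    simp only [δ]
    rw [← ENNReal.ofReal_pow (by positivity), ← ENNReal.ofReal_pow (by positivity),
      ← ENNReal.ofReal_ofNat, ← ENNReal.ofReal_mul (by norm_num)]
    congr 1; ring
  have hδanti : ∀ {k l : ℕ}, k ≤ l → δ l ≤ δ k := fun {k l} hkl => by
    refine pow_le_pow_left' (ENNReal.ofReal_le_ofReal ?_) 2
    exact div_le_div_of_nonneg_right
      (pow_le_pow_of_le_one (by norm_num) (by norm_num) hkl) (by norm_num)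
  have hδlim : Tendsto (fun k => m + ENNReal.ofReal ε * δ k) atTop (𝓝 m) := by
    have h1 : Tendsto (fun k : ℕ => ((1 : ℝ) / 2) ^ k / 4) atTop (𝓝 0) := by
      simpa using (tendsto_pow_atTop_nhds_zero_of_lt_one (r := (1 : ℝ) / 2) (by norm_num)
        (by norm_num)).div_const 4
    have h2 : Tendsto δ atTop (𝓝 0) := by
      have := ((ENNReal.continuous_pow 2).tendsto _).comp (ENNReal.tendsto_ofReal h1)
      rw [ENNReal.ofReal_zero, zero_pow two_ne_zero] at this
      exact this
    have h3 := (ENNReal.Tendsto.const_mul (a := ENNReal.ofReal ε) h2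
      (Or.inr ENNReal.ofReal_ne_top)).const_add m
    simpa using h3
  have hex : ∀ k, ∃ w ∈ U0 u₀, J γ ε w < m + ENNReal.ofReal ε * δ k := by
    intro k
    have hpos : ENNReal.ofReal ε * δ k ≠ 0 := by
      refine mul_ne_zero (by simp [hε]) (pow_ne_zero _ ?_)
      have : (0 : ℝ) < (1 / 2) ^ k / 4 := by positivity
      exact (ENNReal.ofReal_pos.2 this).ne'
    obtain ⟨_, ⟨w, hw, rfl⟩, hlt⟩ := sInf_lt_iff.1 (ENNReal.lt_add_right hm hpos)
    exact ⟨w, hw, hlt⟩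
  choose w hw hJ using hex
  choose G hG using fun k => exists_rep_of_mem_U0 hu₀ (hw k)
  have hJle : ∀ {N k : ℕ}, N ≤ k → J γ ε (w k) ≤ m + ENNReal.ofReal ε * δ N := fun hNk =>
    (hJ _).le.trans (by gcongr; exact hδanti hNk)
  have cauG : ∀ i, ∀ N k l : ℕ, N ≤ k → N ≤ l →
      ∫⁻ z in Q n, ‖Real.exp (-z.2 / 2) * (G k i z - G l i z)‖ₑ ^ 2 ≤
        ENNReal.ofReal ((1 / 2) ^ N / 2) ^ 2 := fun i N k l hk hl => by
    rw [← hδ4]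
    exact (hG k).lintegral_weighted_deriv_sub_le (hG l) hu₀ hγ hε hε1 hm hmin (hJle hk) (hJle hl) i
  have cauw : ∀ N k l : ℕ, N ≤ k → N ≤ l →
      ∫⁻ z in Q n, ‖Real.exp (-z.2) * (w k z - w l z)‖ₑ ^ 2 ≤
        ENNReal.ofReal ((1 / 2) ^ N / 2) ^ 2 := fun N k l hk hl =>
    ((hG k).lintegral_exp_sq_sub_le (hG l)).trans (cauG none N k l hk hl)
  have ca : Continuous fun z : SpaceTime n => Real.exp (-z.2) := by fun_prop
  have cb : Continuous fun z : SpaceTime n => Real.exp (-z.2 / 2) := by fun_prop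
  obtain ⟨v, hvm, hvae, hvlim⟩ := exists_weighted_limit ca (fun z => Real.exp_pos _)
    (fun k => (hG k).aestronglyMeasurable) cauw
  choose H hHm hHae hHlim using fun i => exists_weighted_limit cb (fun z => Real.exp_pos _)
    (fun k => (hG k).aestronglyMeasurable_deriv i) (cauG i)
  have hrep : Rep u₀ v H := Rep.of_weighted_limit hu₀ ca (fun z => Real.exp_pos _) cb
    (fun z => Real.exp_pos _) hG hvm hHm hvlim hHlim
  refine ⟨v, hrep.mem_U0 hu₀, fun u hu => le_trans ?_ (hmin u hu)⟩
  calc J γ ε v = ∫⁻ z in Q n, ENNReal.ofReal (energyDensity γ ε v H z) := hrep.J_eq hε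
    -- The functions and all their derivatives converge almost everywhere, hence so do the energy
    -- densities, and Fatou's lemma gives lower semicontinuity.
    _ = ∫⁻ z in Q n,
        liminf (fun k => ENNReal.ofReal (energyDensity γ ε (w k) (G k) z)) atTop := by
        refine lintegral_congr_ae ?_
        filter_upwards [hvae, ae_all_iff.2 hHae] with z hz hHz
        refine (Tendsto.liminf_eq (ENNReal.tendsto_ofReal ?_)).symm
        refine Tendsto.const_mul _ ((((hHz none).pow 2).add (Tendsto.const_mul _
          (tendsto_finsetSum _ fun i _ => (hHz (some i)).pow 2))).add (Tendsto.const_mul _ ?_))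
        exact (hz.max tendsto_const_nhds).rpow_const (Or.inr (by linarith))
    _ ≤ liminf (fun k => ∫⁻ z in Q n, ENNReal.ofReal (energyDensity γ ε (w k) (G k) z)) atTop :=
        lintegral_liminf_le' fun k => ((hG k).aemeasurable_energyDensity γ ε).ennreal_ofReal
    _ ≤ liminf (fun k => m + ENNReal.ofReal ε * δ k) atTop := by
        refine liminf_le_liminf (Eventually.of_forall fun k => ?_)
        rw [← (hG k).J_eq hε]
        exact (hJ k).le
    _ = m := hδlim.liminf_eq

lemma abs_one_add_div_abs_le (s : ℝ) : |(1 + s / |s|) / 2| ≤ 1 := by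
  have h1 : abs (s / |s|) ≤ 1 := by
    rw [abs_div, abs_abs]
    exact div_self_le_one _
  rw [abs_le] at h1 ⊢
  constructor <;> linarith [h1.1, h1.2]

/-- As `u₀ ≥ 0`, the positive part of the extension is the extension of the positive part, so the
rule for positive parts on all of space-time gives the trace. -/
lemma Rep.posPart (hu₀ : ∀ᵐ x, 0 ≤ u₀ x) {v : SpaceTime n → ℝ}
    {G : Option (Fin n) → SpaceTime n → ℝ} (h : Rep u₀ v G) :
    Rep u₀ (fun z => max (v z) 0) (fun i z => (1 + v z / |v z|) / 2 * G i z) := by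
  have hd := fun i => (h.hasWeakDeriv i).posPart isOpen_Q
  refine ⟨fun r hr => ?_, fun i r hr => ?_, hd, ?_⟩
  · refine (h.memLp r hr).mono ((hd none).1.aestronglyMeasurable.mono_set (Qplus_subset_Q r))
      (Eventually.of_forall fun z => ?_)
    rw [Real.norm_of_nonneg (le_max_right _ _)]
    exact max_le (le_abs_self _) (abs_nonneg _)
  · refine (h.memLp_deriv i r hr).mono ((hd i).2.aestronglyMeasurable.mono_set (Qplus_subset_Q r))
      (Eventually.of_forall fun z => ?_)
    rw [norm_mul]
    exact mul_le_of_le_one_left (norm_nonneg _) (abs_one_add_div_abs_le _)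
  · refine (h.trace.posPart isOpen_univ).congr_ae ?_ (Eventually.of_forall fun z => ?_)
    · rw [Measure.restrict_univ]
      filter_upwards [ae_spaceTime_of_ae_fst hu₀] with z hz
      by_cases hzQ : z ∈ Q n
      · simp only [initialExt_of_mem hzQ]
      · simp only [initialExt_of_notMem hzQ, max_eq_left hz]
    · by_cases hzQ : z ∈ Q n
      · simp only [initialExt_of_mem hzQ, indicator_of_mem hzQ]
      · simp only [indicator_of_notMem hzQ, mul_zero]

lemma Rep.J_posPart_le (hu₀ : ∀ᵐ x, 0 ≤ u₀ x) {γ ε : ℝ} (hε : 0 < ε) {v : SpaceTime n → ℝ}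
    {G : Option (Fin n) → SpaceTime n → ℝ} (h : Rep u₀ v G) :
    J γ ε (fun z => max (v z) 0) ≤ J γ ε v := by
  rw [(h.posPart hu₀).J_eq hε, h.J_eq hε]
  refine lintegral_mono fun z => ENNReal.ofReal_le_ofReal ?_
  have hsq : ∀ i, ((1 + v z / |v z|) / 2 * G i z) ^ 2 ≤ (G i z) ^ 2 := fun i => by
    rw [sq_le_sq, abs_mul]
    exact mul_le_of_le_one_left (abs_nonneg _) (abs_one_add_div_abs_le _)
  unfold energyDensity
  rw [max_eq_left (le_max_right (v z) 0)]
  refine mul_le_mul_of_nonneg_left (add_le_add (add_le_add (hsq none) ?_) le_rfl)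
    (Real.exp_pos _).le
  exact mul_le_mul_of_nonneg_left (Finset.sum_le_sum fun i _ => hsq (some i)) hε.le

end Minimizer

end ParabolicMin

theorem mainTheorem6 (n : ℕ) (hn : 1 ≤ n) (γ : ℝ) (hγ₁ : 1 ≤ γ) (hγ₂ : γ < 2)
    (u₀ : EuclideanSpace ℝ (Fin n) → ℝ)
    (hu₀ : ParabolicMin.MemH1 univ u₀)
    (hu₀γ : MemLp u₀ (ENNReal.ofReal γ) volume)
    (hu₀_nonneg : ∀ᵐ x, 0 ≤ u₀ x) :
    ∃ C : ℝ, 0 < C ∧ ∀ ε : ℝ, 0 < ε → ε < 1 →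
      ∃ v : ParabolicMin.SpaceTime n → ℝ,
        ParabolicMin.IsMinimizer γ ε u₀ v ∧
        (∀ w : ParabolicMin.SpaceTime n → ℝ, ParabolicMin.IsMinimizer γ ε u₀ w →
          w =ᵐ[volume.restrict (ParabolicMin.Q n)] v) ∧
        (∀ᵐ z ∂(volume.restrict (ParabolicMin.Q n)), 0 ≤ v z) ∧
        ParabolicMin.J γ ε v ≤ ENNReal.ofReal (C * ε) := by
  obtain ⟨C, hC, w₁, G₁, hw₁, hJ⟩ := ParabolicMin.exists_competitor hγ₁ hu₀ hu₀γ
  have hloc : LocallyIntegrable u₀ := by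
    have h2 : MemLp u₀ 2 volume := by simpa using hu₀.memLp
    exact h2.locallyIntegrable (by simp)
  refine ⟨C, hC, fun ε hε hε1 => ?_⟩
  have hmem := hw₁.mem_U0 hloc
  obtain ⟨v, hv⟩ := ParabolicMin.exists_isMinimizer hloc hγ₁ hε hε1 hmem
    (ne_top_of_le_ne_top ENNReal.ofReal_ne_top (hJ ε hε))
  have hvC : ParabolicMin.J γ ε v ≤ ENNReal.ofReal (C * ε) := (hv.2 _ hmem).trans (hJ ε hε)
  have hfin := ne_top_of_le_ne_top ENNReal.ofReal_ne_top hvC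
  have huniq := fun w (hw : ParabolicMin.IsMinimizer γ ε u₀ w) => hv.ae_eq hloc hγ₁ hε hε1 hw hfin
  refine ⟨v, hv, huniq, ?_, hvC⟩
  obtain ⟨G, hG⟩ := ParabolicMin.exists_rep_of_mem_U0 hloc hv.1
  -- The positive part is again a minimizer; uniqueness identifies it with `v`.
  have hpos : ParabolicMin.IsMinimizer γ ε u₀ fun z => max (v z) 0 :=
    ⟨(hG.posPart hu₀_nonneg).mem_U0 hloc,
      fun w hw => (hG.J_posPart_le hu₀_nonneg hε).trans (hv.2 w hw)⟩
  filter_upwards [huniq _ hpos] with z hz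
  rw [← hz]
  exact le_max_right _ _
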